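/- For an integer $n\ge 0$ write $n=2d$ or $n=2d+1$, and let $\mathbf q=(T_0,\dots,T_n)$ be the Chebyshev polynomials of the first kind; identify a polynomial of degree at most $n$ with its coefficient vector in $\mathbb R^{n+1}$ in this basis, and let $\mathbf 1$ be the coefficient vector of the constant polynomial $1$. Put $(w_1,w_2)=(1,\,1-z^2)$, $(L_1,L_2)=(d+1,d)$ if $n=2d$, and $(w_1,w_2)=(1-z,\,1+z)$, $(L_1,L_2)=(d+1,d+1)$ if $n=2d+1$. Let $\Sigma\subset\mathbb R^{n+1}$ be the cone of all $w_1\sigma_1+w_2\sigma_2$, where $\sigma_i$ is a sum of squares of polynomials of degree less than $L_i$ (classically, this is the cone of polynomials of degree at most $n$ that are nonnegative on $[-1,1]$), and let $\Sigma^*=\{\mathbf y:\mathbf x^{\mathrm T}\mathbf y\ge0\ \ \forall\,\mathbf x\in\Sigma\}$. Let $\mathbf p_i$ be any basis of the space of polynomials of degree less than $L_i$ ($i=1,2$), let $\Lambda_i$ be the linear map from $\mathbb R^{n+1}$ to the symmetric $L_i\times L_i$ matrices with $\Lambda_i(\mathbf q)=w_i\mathbf p_i\mathbf p_i^{\mathrm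 T}$, let $\Lambda=\Lambda_1\oplus\Lambda_2$, and let $H(\mathbf x)$ be the Hessian of $f(\mathbf x)=-\ln\det\Lambda(\mathbf x)$ at $\mathbf x\in(\Sigma^*)^\circ$. A vector $\mathbf x$ is a certificate for $\mathbf t\in\Sigma$ if $\mathbf x\in(\Sigma^*)^\circ$ and $H(\mathbf x)^{-1}\mathbf t\in\Sigma^*$. The bit size of an integer $y$ is $1+\lceil\log_2(|y|+1)\rceil$. Then the following hold. (1) For every $n$, the minimum $k_1^{\mathbf 1}=\min\{\mathbf 1^{\mathrm T}\mathbf v : \mathbf v\in\Sigma^*,\ \|\mathbf v\|_\infty=1\}$ exists, and $k_1^{\mathbf 1}\ge 1$. (2) For every $n$, the Chebyshev nodes of the second kind $z_l=\cos(\pi l/n)$, $l=0,\dots,n$ (the single node $1$ if $n=0$), lie in $[-1,1]$, every polynomial of degree at most $n$ is determined by its values at them, and there are $\alpha_0,\dots,\alpha_n>0$ such that $\mathbf M=\sum_{l=0}^{n}\alpha_l\,\mathbf q(z_l)\mathbf q(z_l)^{\mathrm T}$ is positive definite with $\mathrm{cond}(\mathbf M)=\lambda_{\max}(\mathbf M)/\lambda_{\min}(\mathbf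 M)\le 4$. (3) There is an absolute constant $K$ such that for all $d\ge 0$, all $n\in\{2d,2d+1\}$, all bases $\mathbf p_1,\mathbf p_2$, all $\mathbf t\in\Sigma^\circ$ and all $\varepsilon>0$ such that $\mathbf t-\varepsilon\mathbf 1$ lies on the boundary of $\Sigma$, there is a certificate $\bar{\mathbf y}\in\mathbb Z^{n+1}$ for $\mathbf t$ with $$\|\bar{\mathbf y}\|_\infty\le\frac12+\frac{2d+2}{\varepsilon}\left\lceil 3\sqrt{2d+2}\,\|\mathbf t\|_2\right\rceil,$$ and such that both $\log\|\bar{\mathbf y}\|_\infty$ and the bit size of each component of $\bar{\mathbf y}$ are at most $$K\Big(\log(d+2)+\log\|\mathbf t\|_2+\log\frac1\varepsilon\Big).$$ -/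

import Mathlib

open Polynomial Matrix

noncomputable section

namespace ChebCert

/-- The vector of basis polynomials `q = (T_0, …, T_n)`, evaluated at a point `z`. -/
def q (n : ℕ) (z : ℝ) : Fin (n + 1) → ℝ := fun l => (Chebyshev.T ℝ (l : ℕ)).eval z

/-- The polynomial of degree at most `n` with Chebyshev coefficient vector `s`. -/
def toPoly (n : ℕ) (s : Fin (n + 1) → ℝ) : ℝ[X] :=
  ∑ l : Fin (n + 1), C (s l) * Chebyshev.T ℝ (l : ℕ)

/-- The coefficient vector of the constant one polynomial. -/
def oneVec (n : ℕ) : Fin (n + 1) → ℝ := Pi.single 0 1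

/-- The weights describing `[-1,1]`: `1, 1 - z²` for even `n`, and `1 - z, 1 + z` for odd `n`. -/
def weight (n : ℕ) : Fin 2 → ℝ[X] :=
  if Even n then ![1, 1 - X ^ 2] else ![1 - X, 1 + X]

/-- The dimensions `L₁, L₂` of the spaces of polynomials whose squares are multiplied by the two
weights: `d + 1, d` when `n = 2 d`, and `d + 1, d + 1` when `n = 2 d + 1`. -/
def blockSize (n : ℕ) : Fin 2 → ℕ := ![n / 2 + 1, (n + 1) / 2]

/-- Sums of squares of polynomials of degree less than `L`. -/
def IsSOS (L : ℕ) (σ : ℝ[X]) : Prop :=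
  ∃ (k : ℕ) (r : Fin k → ℝ[X]), (∀ j, r j ∈ degreeLT ℝ L) ∧ σ = ∑ j, r j ^ 2

/-- The cone `Σ` of (Chebyshev coefficient vectors of) weighted sums of squares of degree at
most `n`. -/
def wsosCone (n : ℕ) : Set (Fin (n + 1) → ℝ) :=
  {s | ∃ σ : Fin 2 → ℝ[X], (∀ i, IsSOS (blockSize n i) (σ i)) ∧
    toPoly n s = ∑ i, weight n i * σ i}

/-- The dual cone of a subset of `ℝ^U`, for the standard inner product. -/
def dualCone {ι : Type*} [Fintype ι] (K : Set (ι → ℝ)) : Set (ι → ℝ) :=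
  {y | ∀ x ∈ K, 0 ≤ x ⬝ᵥ y}

/-- The values over which the constant `k₁^e` is the minimum. -/
def k1Set (n : ℕ) (e : Fin (n + 1) → ℝ) : Set ℝ :=
  {a | ∃ v ∈ dualCone (wsosCone n), ‖v‖ = 1 ∧ a = e ⬝ᵥ v}

/-- The constant `k₁^e`. -/
def k1 (n : ℕ) (e : Fin (n + 1) → ℝ) : ℝ := sInf (k1Set n e)

/-- A finite family of points is unisolvent for the polynomials of degree at most `n`. -/
def Unisolvent (n : ℕ) {ι : Type*} (z : ι → ℝ) : Prop :=
  ∀ p ∈ degreeLT ℝ (n + 1), ∀ r ∈ degreeLT ℝ (n + 1),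
    (∀ i, p.eval (z i) = r.eval (z i)) → p = r

/-- The matrix `M = ∑ αᵢ q(zᵢ) q(zᵢ)ᵀ`. -/
def matM (n : ℕ) {ι : Type*} [Fintype ι] (α z : ι → ℝ) :
    Matrix (Fin (n + 1)) (Fin (n + 1)) ℝ :=
  ∑ i, α i • vecMulVec (q n (z i)) (q n (z i))

/-- The condition number `λ_max / λ_min` of a positive definite matrix. -/
def condNumber {ι : Type*} [Fintype ι] [DecidableEq ι] (M : Matrix ι ι ℝ) : ℝ :=
  sSup (spectrum ℝ M) / sInf (spectrum ℝ M)

/-- The Chebyshev nodes of the second kind `cos (l π / n)`, `l = 0, …, n`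
(the single node `1` when `n = 0`). -/
def chebNode (n : ℕ) (l : Fin (n + 1)) : ℝ := Chebyshev.node n l

/-- The Chebyshev polynomials `T_0, T_1, …` as a basis of `ℝ[X]`. -/
def chebBasis : Module.Basis ℕ ℝ ℝ[X] :=
  (Chebyshev.chebyshevTsequence ℝ).basis fun i =>
    (leadingCoeff_ne_zero.mpr ((Chebyshev.chebyshevTsequence ℝ).ne_zero i)).isUnit

theorem chebBasis_apply (i : ℕ) : chebBasis i = Chebyshev.T ℝ i := by
  rw [chebBasis, Polynomial.Sequence.basis_eq_self]
  rfl

/-- A choice of the bases `p₁, p₂`. -/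
abbrev PBases (n : ℕ) : Type :=
  (i : Fin 2) → Module.Basis (Fin (blockSize n i)) ℝ (degreeLT ℝ (blockSize n i))

/-- The linear map `Λᵢ` with `Λᵢ(q) = wᵢ pᵢ pᵢᵀ`: the `(j,k)` entry of `Λᵢ(v)` replaces each
`T_l` in the Chebyshev expansion of `wᵢ p_{i,j} p_{i,k}` by `v_l`. -/
def LamBlock (n : ℕ) (p : PBases n) (i : Fin 2) (v : Fin (n + 1) → ℝ) :
    Matrix (Fin (blockSize n i)) (Fin (blockSize n i)) ℝ :=
  Matrix.of fun j k => ∑ l : Fin (n + 1),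
    chebBasis.repr (weight n i * (p i j : ℝ[X]) * (p i k : ℝ[X])) l * v l

/-- The map `Λ = Λ₁ ⊕ Λ₂`. -/
def Lam (n : ℕ) (p : PBases n) (v : Fin (n + 1) → ℝ) :
    Matrix ((i : Fin 2) × Fin (blockSize n i)) ((i : Fin 2) × Fin (blockSize n i)) ℝ :=
  Matrix.blockDiagonal' fun i => LamBlock n p i v

/-- The barrier function `f(x) = - ln det Λ(x)`. -/
def barrier (n : ℕ) (p : PBases n) (x : Fin (n + 1) → ℝ) : ℝ :=
  -Real.log (Lam n p x).det

/-- The Hessian matrix of second partial derivatives of a function on `ℝ^U`. -/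
def hessian {ι : Type*} [Fintype ι] [DecidableEq ι] (f : (ι → ℝ) → ℝ) (x : ι → ℝ) :
    Matrix ι ι ℝ :=
  Matrix.of fun i j =>
    fderiv ℝ (fun y => fderiv ℝ f y (Pi.single j 1)) x (Pi.single i 1)

/-- `x` is a dual certificate of `s`: `x ∈ (Σ*)°` and `H(x)⁻¹ s ∈ Σ*`. -/
def IsDualCertificate (n : ℕ) (p : PBases n) (s x : Fin (n + 1) → ℝ) : Prop :=
  x ∈ interior (dualCone (wsosCone n)) ∧
    (hessian (barrier n p) x)⁻¹ *ᵥ s ∈ dualCone (wsosCone n)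

/-- The bit size `1 + ⌈log₂(|y| + 1)⌉` of an integer. -/
def bitSize (y : ℤ) : ℤ := 1 + ⌈Real.logb 2 (|(y : ℝ)| + 1)⌉

end ChebCert

end

open ChebCert

/-! The constant `k1`: half-angle identities write `1 ± T_l` as weighted sums of squares, so every
`v ∈ Σ*` has `|v l| ≤ v 0`. Hence `‖v‖ = v 0 = 𝟏ᵀv`, and the set being minimised over is `{1}`.

The conditioning: with trapezoidal weights at the Chebyshev nodes the matrix `M` is diagonal, with
entries `n/2` and `n` (for `n > 0`), by discrete orthogonality of cosines.

The integer certificate: write `⟨A, B⟩_S = tr(S⁻¹AS⁻¹B)`; at `S = Λ(x)` this form is the Hessian of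
the barrier. Replace `t` by `t/N` with `N = 3√D‖t‖₂` and `D = 2d+2`, which does not change the set
of certificates. Maximising `det Λ` on a slice of `Σ*` yields `x` with `-∇f(x) = t/N`
(`exists_gradient_certificate`). Every `y` in the open unit local ball at `x` is a certificate
(`isDualCertificate_of_traceForm_lt`): for `w = H(y)⁻¹(t/N)`, the difference `w - y` is at most as
long at `y` as `y - x` is at `x`, so `w` lies in the unit ball at `y`, hence in `Σ*`. The local norm
at `x` is at most `√2‖t/N‖₂` times the Euclidean norm (`traceForm_le_of_gradient`; the `√2` comes
from the diagonal `M`), so rounding `x` to integers stays in the ball. Finally `ε/N · ‖x‖ ≤ (t/N)ᵀx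
= tr I = n + 1` bounds the size. -/

open ChebCert

/-! ### Local norms on symmetric matrices -/

section TraceForm

theorem sq_dotProduct_mulVec_le {ι : Type*} [Fintype ι] (E : Matrix ι ι ℝ) (u : ι → ℝ) :
    (u ⬝ᵥ E *ᵥ u) ^ 2 ≤ (∑ i, ∑ j, E i j * E i j) * (u ⬝ᵥ u) ^ 2 := by
  have h1 : u ⬝ᵥ E *ᵥ u = ∑ p : ι × ι, E p.1 p.2 * (u p.1 * u p.2) := by
    rw [Fintype.sum_prod_type]
    simp only [dotProduct, mulVec, Finset.mul_sum]
    exact Finset.sum_congr rfl fun i _ => Finset.sum_congr rfl fun j _ => by ring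
  have h2 : (u ⬝ᵥ u) ^ 2 = ∑ p : ι × ι, (u p.1 * u p.2) ^ 2 := by
    rw [Fintype.sum_prod_type, sq]
    simp only [dotProduct, Finset.sum_mul_sum]
    exact Finset.sum_congr rfl fun i _ => Finset.sum_congr rfl fun j _ => by ring
  have h3 : ∑ i, ∑ j, E i j * E i j = ∑ p : ι × ι, E p.1 p.2 ^ 2 := by
    rw [Fintype.sum_prod_type]
    simp only [sq]
  rw [h1, h2, h3]
  exact Finset.sum_mul_sq_le_sq_mul_sq _ _ _

variable {ι : Type*} [Fintype ι] [DecidableEq ι]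

/-- The local inner product `tr(S⁻¹ A S⁻¹ B)` on symmetric matrices. -/
noncomputable def traceForm (S A B : Matrix ι ι ℝ) : ℝ := (S⁻¹ * A * S⁻¹ * B).trace

theorem traceForm_comm (S A B : Matrix ι ι ℝ) : traceForm S A B = traceForm S B A := by
  rw [traceForm, traceForm, Matrix.mul_assoc (S⁻¹ * A), trace_mul_comm, ← Matrix.mul_assoc]

theorem traceForm_sub_left (S A A' B : Matrix ι ι ℝ) :
    traceForm S (A - A') B = traceForm S A B - traceForm S A' B := by
  simp [traceForm, Matrix.mul_sub, Matrix.sub_mul]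

theorem traceForm_smul_left (S A B : Matrix ι ι ℝ) (c : ℝ) :
    traceForm S (c • A) B = c * traceForm S A B := by
  simp [traceForm]

theorem traceForm_sub_right (S A B B' : Matrix ι ι ℝ) :
    traceForm S A (B - B') = traceForm S A B - traceForm S A B' := by
  simp [traceForm, Matrix.mul_sub]

theorem Matrix.PosDef.exists_inv_eq_mul_transpose {S : Matrix ι ι ℝ} (hS : S.PosDef) :
    ∃ R : Matrix ι ι ℝ, IsUnit R ∧ S⁻¹ = R * Rᵀ ∧ Rᵀ * S * R = 1 := by
  obtain ⟨B, hB⟩ : ∃ B : Matrix ι ι ℝ, S⁻¹ = Bᴴ * B := by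
    open scoped MatrixOrder in
    have h : 0 ≤ S⁻¹ := Matrix.nonneg_iff_posSemidef.2 hS.inv.posSemidef
    obtain ⟨B, hB⟩ := CStarAlgebra.nonneg_iff_eq_star_mul_self.1 h
    exact ⟨B, hB⟩
  rw [conjTranspose_eq_transpose_of_trivial] at hB
  have hu : IsUnit S⁻¹.det := (isUnit_iff_isUnit_det _).1 hS.inv.isUnit
  have hBu : IsUnit B.det := by
    rw [hB, det_mul] at hu
    exact isUnit_of_mul_isUnit_right hu
  have hSu : IsUnit S.det := (isUnit_iff_isUnit_det _).1 hS.isUnit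
  refine ⟨Bᵀ, ?_, by simpa using hB, ?_⟩
  · rw [isUnit_iff_isUnit_det, det_transpose]; exact hBu
  · rw [transpose_transpose]
    have h1 : S * Bᵀ * B = 1 := by
      rw [Matrix.mul_assoc, ← hB, Matrix.mul_nonsing_inv _ hSu]
    have h2 : B * (S * Bᵀ) = 1 := mul_eq_one_comm.1 h1
    rw [Matrix.mul_assoc]; exact h2

theorem traceForm_eq_sum {S R A B : Matrix ι ι ℝ} (h : S⁻¹ = R * Rᵀ) (hB : B.IsSymm) :
    traceForm S A B = ∑ i, ∑ j, (Rᵀ * A * R) i j * (Rᵀ * B * R) i j := by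
  have h1 : traceForm S A B = ((Rᵀ * A * R) * (Rᵀ * B * R)ᵀ).trace := by
    rw [traceForm, h, transpose_mul, transpose_mul, hB.eq, transpose_transpose,
      show R * Rᵀ * A * (R * Rᵀ) * B = R * (Rᵀ * A * R * (Rᵀ * B)) by
        simp only [Matrix.mul_assoc], trace_mul_comm]
    simp only [Matrix.mul_assoc]
  rw [h1]
  generalize Rᵀ * A * R = A'
  generalize Rᵀ * B * R = B'
  simp [Matrix.trace, Matrix.mul_apply]

theorem traceForm_self_nonneg {S A : Matrix ι ι ℝ} (hS : S.PosDef) (hA : A.IsSymm) :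
    0 ≤ traceForm S A A := by
  obtain ⟨R, -, h, -⟩ := hS.exists_inv_eq_mul_transpose
  rw [traceForm_eq_sum h hA]
  exact Finset.sum_nonneg fun i _ => Finset.sum_nonneg fun j _ => mul_self_nonneg _

theorem traceForm_self_eq_zero {S A : Matrix ι ι ℝ} (hS : S.PosDef) (hA : A.IsSymm)
    (h0 : traceForm S A A = 0) : A = 0 := by
  obtain ⟨R, hR, h, -⟩ := hS.exists_inv_eq_mul_transpose
  rw [traceForm_eq_sum h hA] at h0
  have h1 : Rᵀ * A * R = 0 := by
    ext i j
    have h2 := (Finset.sum_eq_zero_iff_of_nonneg (fun i _ =>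
      Finset.sum_nonneg fun j _ => mul_self_nonneg _)).1 h0 i (Finset.mem_univ _)
    have h3 := (Finset.sum_eq_zero_iff_of_nonneg (fun j _ => mul_self_nonneg _)).1 h2 j
      (Finset.mem_univ _)
    simpa using h3
  have hRt : IsUnit Rᵀ := by
    rw [isUnit_iff_isUnit_det, det_transpose]; exact (isUnit_iff_isUnit_det _).1 hR
  rw [hR.mul_left_eq_zero] at h1
  rwa [hRt.mul_right_eq_zero] at h1

/-- The congruence `x = Ru` with `RᵀSR = 1` turns `S` into the identity and the local norm of `E`
into the Frobenius norm of `RᵀER`, which bounds its quadratic form. -/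
theorem exists_conj_form {S E : Matrix ι ι ℝ} (hS : S.PosDef) (hE : E.IsSymm) :
    ∀ x : ι → ℝ, ∃ u : ι → ℝ, (x ≠ 0 → 0 < u ⬝ᵥ u) ∧
      ∃ a : ℝ, x ⬝ᵥ (S + E) *ᵥ x = u ⬝ᵥ u + a ∧ a ^ 2 ≤ traceForm S E E * (u ⬝ᵥ u) ^ 2 := by
  obtain ⟨R, hR, h, h1⟩ := hS.exists_inv_eq_mul_transpose
  intro x
  obtain ⟨u, rfl⟩ : ∃ u, x = R *ᵥ u := by
    refine ⟨R⁻¹ *ᵥ x, ?_⟩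
    rw [mulVec_mulVec, Matrix.mul_nonsing_inv _ ((isUnit_iff_isUnit_det _).1 hR), one_mulVec]
  refine ⟨u, ?_, u ⬝ᵥ (Rᵀ * E * R) *ᵥ u, ?_, ?_⟩
  · intro hx
    have hu : u ≠ 0 := by rintro rfl; simp at hx
    have := Matrix.PosDef.one (n := ι) (R := ℝ) |>.dotProduct_mulVec_pos hu
    simpa using this
  · have key : ∀ M : Matrix ι ι ℝ, (R *ᵥ u) ⬝ᵥ M *ᵥ (R *ᵥ u) = u ⬝ᵥ (Rᵀ * M * R) *ᵥ u := by
      intro M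
      rw [dotProduct_comm (R *ᵥ u), dotProduct_mulVec, ← mulVec_transpose, dotProduct_comm]
      simp [Matrix.mul_assoc]
    rw [key, Matrix.mul_add, Matrix.add_mul, h1, add_mulVec, dotProduct_add, one_mulVec]
  · rw [traceForm_eq_sum h hE]
    exact sq_dotProduct_mulVec_le _ _

/-- The closed unit ball of the local norm at `S` lies in the positive semidefinite cone. -/
theorem posSemidef_add_of_traceForm_le {S E : Matrix ι ι ℝ} (hS : S.PosDef) (hE : E.IsSymm)
    (h : traceForm S E E ≤ 1) : (S + E).PosSemidef := by
  refine .of_dotProduct_mulVec_nonneg (hS.isHermitian.add hE) fun x => ?_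
  obtain ⟨u, -, a, h1, h2⟩ := exists_conj_form hS hE x
  rw [star_trivial, h1]
  have h3 : 0 ≤ u ⬝ᵥ u := by simpa using dotProduct_star_self_nonneg u
  have h4 : |a| ≤ u ⬝ᵥ u := abs_le_of_sq_le_sq (by nlinarith [sq_nonneg (u ⬝ᵥ u)]) h3
  linarith [neg_abs_le a]

/-- The open unit ball of the local norm at `S` lies in the positive definite cone. -/
theorem posDef_add_of_traceForm_lt {S E : Matrix ι ι ℝ} (hS : S.PosDef) (hE : E.IsSymm)
    (h : traceForm S E E < 1) : (S + E).PosDef := by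
  refine .of_dotProduct_mulVec_pos (hS.isHermitian.add hE) fun x hx => ?_
  obtain ⟨u, h0, a, h1, h2⟩ := exists_conj_form hS hE x
  rw [star_trivial, h1]
  have h3 := h0 hx
  have h4 : |a| < u ⬝ᵥ u := by
    refine abs_lt_of_sq_lt_sq ?_ h3.le
    have : 0 < (u ⬝ᵥ u) ^ 2 := by positivity
    nlinarith
  linarith [neg_abs_le a]

/-- Triangle inequality for the local norm, in which a positive semidefinite `V` is no longer than
`tr(S⁻¹V)`. At a gradient certificate these traces become inner products with `t`. -/
theorem traceForm_self_sum_le {κ : Type*} [Fintype κ] {S : Matrix ι ι ℝ} (hS : S.PosDef)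
    {V : κ → Matrix ι ι ℝ} (hV : ∀ k, (V k).PosSemidef) (c : κ → ℝ) :
    traceForm S (∑ k, c k • V k) (∑ k, c k • V k) ≤ (∑ k, |c k| * (S⁻¹ * V k).trace) ^ 2 := by
  obtain ⟨R, hR, h, h1⟩ := hS.exists_inv_eq_mul_transpose
  have hsym : (∑ k, c k • V k).IsSymm := by
    simp only [Matrix.IsSymm, transpose_sum, transpose_smul]
    exact Finset.sum_congr rfl fun k _ => by
      rw [← conjTranspose_eq_transpose_of_trivial, (hV k).isHermitian.eq]
  let _ : NormedAddCommGroup (Matrix ι ι ℝ) := Matrix.frobeniusNormedAddCommGroup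
  let _ : NormedSpace ℝ (Matrix ι ι ℝ) := Matrix.frobeniusNormedSpace
  have hn : ∀ A : Matrix ι ι ℝ, ‖A‖ ^ 2 = ∑ i, ∑ j, A i j * A i j := by
    intro A
    rw [Matrix.frobenius_norm_def, ← Real.sqrt_eq_rpow, Real.sq_sqrt]
    · simp [sq]
    · positivity
  -- Writing `RᵀVR = BᵀB`, submultiplicativity bounds its Frobenius norm by `‖B‖²`, which is its
  -- trace.
  have hpsd : ∀ k, ‖Rᵀ * V k * R‖ ≤ (S⁻¹ * V k).trace := by
    intro k
    have hW : (Rᵀ * V k * R).PosSemidef := by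
      have := (hV k).conjTranspose_mul_mul_same R
      rwa [conjTranspose_eq_transpose_of_trivial] at this
    obtain ⟨B, hB⟩ : ∃ B : Matrix ι ι ℝ, Rᵀ * V k * R = Bᴴ * B := by
      open scoped MatrixOrder in
      obtain ⟨B, hB⟩ := CStarAlgebra.nonneg_iff_eq_star_mul_self.1
        (Matrix.nonneg_iff_posSemidef.2 hW)
      exact ⟨B, hB⟩
    have ht : (S⁻¹ * V k).trace = ‖B‖ ^ 2 := by
      rw [h, Matrix.mul_assoc, trace_mul_comm, hB, hn,
        conjTranspose_eq_transpose_of_trivial, trace_mul_comm]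
      simp [Matrix.trace, Matrix.mul_apply]
    rw [ht, hB, sq]
    refine (Matrix.frobenius_norm_mul _ _).trans ?_
    rw [Matrix.frobenius_norm_conjTranspose]
  rw [traceForm_eq_sum h hsym, ← hn]
  refine pow_le_pow_left₀ (norm_nonneg _) ?_ 2
  have : Rᵀ * (∑ k, c k • V k) * R = ∑ k, c k • (Rᵀ * V k * R) := by
    simp [Matrix.mul_sum, Matrix.sum_mul]
  rw [this]
  refine (norm_sum_le _ _).trans (Finset.sum_le_sum fun k _ => ?_)
  rw [norm_smul, Real.norm_eq_abs]
  exact mul_le_mul_of_nonneg_left (hpsd k) (abs_nonneg _)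

/-- If `W` represents the difference `X⁻¹ - Y⁻¹` in the local inner product at `Y`, then it is at
most as long at `Y` as `Y - X` is at `X`. -/
theorem traceForm_newton_le {X Y W : Matrix ι ι ℝ} (hX : X.PosDef) (hY : Y.PosDef)
    (hW : W.IsSymm) (h : traceForm Y W W = (X⁻¹ * W).trace - (Y⁻¹ * W).trace) :
    traceForm Y W W ≤ traceForm X (Y - X) (Y - X) := by
  have hXu : IsUnit X.det := (isUnit_iff_isUnit_det _).1 hX.isUnit
  have hYu : IsUnit Y.det := (isUnit_iff_isUnit_det _).1 hY.isUnit
  have hXi : X⁻¹ᵀ = X⁻¹ := by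
    rw [← conjTranspose_eq_transpose_of_trivial, hX.inv.isHermitian.eq]
  have hYt : Yᵀ = Y := by
    rw [← conjTranspose_eq_transpose_of_trivial, hY.isHermitian.eq]
  -- `G` represents `X⁻¹ - Y⁻¹` at `Y` among all symmetric matrices, and is exactly as long at `Y`
  -- as `Y - X` at `X`. The hypothesis says `G - W` is orthogonal to `W`, so Pythagoras gives the
  -- bound.
  obtain ⟨G, hG⟩ : ∃ G, G = Y * X⁻¹ * Y - Y := ⟨_, rfl⟩
  have hGs : G.IsSymm := by
    simp [Matrix.IsSymm, hG, hXi, hYt, Matrix.mul_assoc]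
  have e1 : Y⁻¹ * G = X⁻¹ * Y - 1 := by
    rw [hG, Matrix.mul_sub, Matrix.nonsing_inv_mul _ hYu, ← Matrix.mul_assoc, ← Matrix.mul_assoc,
      Matrix.nonsing_inv_mul _ hYu, Matrix.one_mul]
  have e2 : X⁻¹ * (Y - X) = X⁻¹ * Y - 1 := by
    rw [Matrix.mul_sub, Matrix.nonsing_inv_mul _ hXu]
  have hGG : traceForm Y G G = traceForm X (Y - X) (Y - X) := by
    rw [traceForm, traceForm, Matrix.mul_assoc (Y⁻¹ * G), Matrix.mul_assoc (X⁻¹ * (Y - X)), e1, e2]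
  have hGW : traceForm Y G W = traceForm Y W W := by
    rw [h, traceForm, e1, Matrix.sub_mul, Matrix.sub_mul, trace_sub, Matrix.one_mul,
      Matrix.mul_assoc X⁻¹, Matrix.mul_nonsing_inv _ hYu, Matrix.mul_one]
  have h0 := traceForm_self_nonneg hY (A := G - W) (hGs.sub hW)
  rw [traceForm_sub_left, traceForm_sub_right, traceForm_sub_right, traceForm_comm Y W G, hGW,
    hGG] at h0
  linarith

end TraceForm

/-! ### Coefficient vectors as linear functionals on polynomials -/

section MomentFunctional

/-- The linear functional on polynomials replacing each `T_l` in the Chebyshev expansion by `v l`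
(and by `0` for `l > n`). -/
noncomputable def momentFun (n : ℕ) (v : Fin (n + 1) → ℝ) : ℝ[X] →ₗ[ℝ] ℝ :=
  ∑ l : Fin (n + 1), v l • (Finsupp.lapply (l : ℕ) ∘ₗ chebBasis.repr.toLinearMap)

theorem momentFun_apply (n : ℕ) (v : Fin (n + 1) → ℝ) (p : ℝ[X]) :
    momentFun n v p = ∑ l : Fin (n + 1), chebBasis.repr p l * v l := by
  simp [momentFun, mul_comm]

theorem momentFun_T (n : ℕ) (v : Fin (n + 1) → ℝ) (l : Fin (n + 1)) :
    momentFun n v (Chebyshev.T ℝ (l : ℕ)) = v l := by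
  rw [momentFun_apply, ← chebBasis_apply, Module.Basis.repr_self]
  rw [Finset.sum_eq_single l]
  · simp
  · intro b _ hb
    rw [Finsupp.single_apply, if_neg (by simpa [Fin.ext_iff] using hb.symm), zero_mul]
  · simp

theorem momentFun_toPoly (n : ℕ) (v s : Fin (n + 1) → ℝ) :
    momentFun n v (toPoly n s) = s ⬝ᵥ v := by
  simp only [toPoly, map_sum, ← smul_eq_C_mul, map_smul, momentFun_T, dotProduct, smul_eq_mul]

theorem exists_toPoly_eq {n : ℕ} {p : ℝ[X]} (hp : p ∈ degreeLT ℝ (n + 1)) :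
    ∃ s, toPoly n s = p := by
  rw [← Sequence.span_degreeLT (Chebyshev.chebyshevTsequence ℝ) (fun i _ =>
    (leadingCoeff_ne_zero.mpr ((Chebyshev.chebyshevTsequence ℝ).ne_zero i)).isUnit)] at hp
  induction hp using Submodule.span_induction with
  | mem x hx =>
    obtain ⟨i, hi, rfl⟩ := hx
    refine ⟨Pi.single ⟨i, by simpa using hi⟩ 1, ?_⟩
    rw [toPoly, Finset.sum_eq_single ⟨i, by simpa using hi⟩]
    · simp; rfl
    · intro b _ hb; simp [Pi.single_eq_of_ne hb]
    · simp
  | zero => exact ⟨0, by simp [toPoly]⟩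
  | add x y _ _ hx hy =>
    obtain ⟨a, rfl⟩ := hx
    obtain ⟨b, rfl⟩ := hy
    exact ⟨a + b, by simp [toPoly, add_mul, Finset.sum_add_distrib]⟩
  | smul c x _ hx =>
    obtain ⟨a, rfl⟩ := hx
    exact ⟨c • a, by simp [toPoly, smul_eq_C_mul, Finset.mul_sum, mul_assoc]⟩

theorem eval_toPoly (n : ℕ) (s : Fin (n + 1) → ℝ) (z : ℝ) :
    (toPoly n s).eval z = s ⬝ᵥ q n z := by
  simp [toPoly, eval_finsetSum, q, dotProduct]

theorem momentFun_q {n : ℕ} {p : ℝ[X]} (hp : p ∈ degreeLT ℝ (n + 1)) (z : ℝ) :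
    momentFun n (q n z) p = p.eval z := by
  obtain ⟨s, rfl⟩ := exists_toPoly_eq hp
  rw [momentFun_toPoly, eval_toPoly]

theorem momentFun_add (n : ℕ) (v w : Fin (n + 1) → ℝ) (p : ℝ[X]) :
    momentFun n (v + w) p = momentFun n v p + momentFun n w p := by
  simp [momentFun_apply, mul_add, Finset.sum_add_distrib]

theorem momentFun_smul (n : ℕ) (c : ℝ) (v : Fin (n + 1) → ℝ) (p : ℝ[X]) :
    momentFun n (c • v) p = c * momentFun n v p := by
  simp only [momentFun_apply, Pi.smul_apply, smul_eq_mul, Finset.mul_sum]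
  exact Finset.sum_congr rfl fun _ _ => by ring

theorem momentFun_sum (n : ℕ) {κ : Type*} (s : Finset κ) (v : κ → Fin (n + 1) → ℝ) (p : ℝ[X]) :
    momentFun n (∑ k ∈ s, v k) p = ∑ k ∈ s, momentFun n (v k) p := by
  classical
  induction s using Finset.induction_on with
  | empty => simp [momentFun_apply]
  | insert a s ha ih => rw [Finset.sum_insert ha, Finset.sum_insert ha, momentFun_add, ih]

end MomentFunctional

/-! ### The dual cone, squares behind `1 ± T_l`, and the constant `k1` -/

section Cone

theorem weight_even {n : ℕ} (h : Even n) : weight n = ![1, 1 - X ^ 2] := if_pos h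

theorem weight_odd {n : ℕ} (h : ¬ Even n) : weight n = ![1 - X, 1 + X] := if_neg h

theorem natDegree_weight_le (n : ℕ) (i : Fin 2) :
    (weight n i).natDegree + 2 * blockSize n i ≤ n + 2 := by
  have h1 : (1 - X : ℝ[X]).natDegree ≤ 1 := by compute_degree
  have h2 : (1 + X : ℝ[X]).natDegree ≤ 1 := by compute_degree
  have h3 : (1 - X ^ 2 : ℝ[X]).natDegree ≤ 2 := by compute_degree
  by_cases h : Even n
  · rw [weight_even h]
    rw [Nat.even_iff] at h
    fin_cases i <;> simp [blockSize] <;> omega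
  · rw [weight_odd h]
    rw [Nat.even_iff] at h
    fin_cases i <;> simp [blockSize] <;> omega

/-- Ensures that `momentFun`, which discards every `T_l` with `l > n`, loses nothing on the products
occurring in `Λ`. -/
theorem weight_mul_mul_mem {n : ℕ} {i : Fin 2} {r s : ℝ[X]} (hr : r ∈ degreeLT ℝ (blockSize n i))
    (hs : s ∈ degreeLT ℝ (blockSize n i)) : weight n i * (r * s) ∈ degreeLT ℝ (n + 1) := by
  rcases eq_or_ne r 0 with rfl | hr0
  · simp
  rcases eq_or_ne s 0 with rfl | hs0
  · simp
  have h1 : r.natDegree < blockSize n i := (natDegree_lt_iff_degree_lt hr0).2 (mem_degreeLT.1 hr)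
  have h2 : s.natDegree < blockSize n i := (natDegree_lt_iff_degree_lt hs0).2 (mem_degreeLT.1 hs)
  have h3 := natDegree_weight_le n i
  have h4 : (weight n i * (r * s)).natDegree ≤ (weight n i).natDegree + (r.natDegree + s.natDegree) :=
    natDegree_mul_le.trans (by gcongr; exact natDegree_mul_le)
  rw [mem_degreeLT]
  refine degree_le_natDegree.trans_lt ?_
  exact_mod_cast (by omega : (weight n i * (r * s)).natDegree < n + 1)

theorem weight_eval_nonneg (n : ℕ) (i : Fin 2) {z : ℝ} (hz : z ∈ Set.Icc (-1 : ℝ) 1) :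
    0 ≤ (weight n i).eval z := by
  obtain ⟨h1, h2⟩ := hz
  by_cases h : Even n
  · rw [weight_even h]
    fin_cases i <;> simp
    exact abs_le.2 ⟨h1, h2⟩
  · rw [weight_odd h]
    fin_cases i <;> simp <;> linarith

theorem weight_eval_pos (n : ℕ) (i : Fin 2) {z : ℝ} (hz : z ∈ Set.Ioo (-1 : ℝ) 1) :
    0 < (weight n i).eval z := by
  obtain ⟨h1, h2⟩ := hz
  by_cases h : Even n
  · rw [weight_even h]
    fin_cases i <;> simp
    exact abs_lt.2 ⟨h1, h2⟩
  · rw [weight_odd h]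
    fin_cases i <;> simp <;> linarith

theorem mem_dualCone_wsosCone_iff {n : ℕ} {v : Fin (n + 1) → ℝ} :
    v ∈ dualCone (wsosCone n) ↔
      ∀ i, ∀ r ∈ degreeLT ℝ (blockSize n i), 0 ≤ momentFun n v (weight n i * (r * r)) := by
  classical
  constructor
  · intro hv i r hr
    obtain ⟨s, hs⟩ := exists_toPoly_eq (weight_mul_mul_mem hr hr)
    rw [← hs, momentFun_toPoly]
    refine hv s ⟨Pi.single i (r * r), fun j => ?_, ?_⟩
    · rcases eq_or_ne j i with rfl | hj
      · exact ⟨1, fun _ => r, fun _ => hr, by simp [sq]⟩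
      · exact ⟨0, fun _ => 0, by simp, by simp [hj]⟩
    · rw [hs, Finset.sum_eq_single i] <;> simp +contextual
  · rintro h s ⟨σ, hσ, hs⟩
    rw [← momentFun_toPoly, hs, map_sum]
    refine Finset.sum_nonneg fun i _ => ?_
    obtain ⟨k, r, hr, hk⟩ := hσ i
    rw [hk, Finset.mul_sum, map_sum]
    exact Finset.sum_nonneg fun j _ => by simpa [sq] using h i (r j) (hr j)

theorem q_mem_dualCone (n : ℕ) {z : ℝ} (hz : z ∈ Set.Icc (-1 : ℝ) 1) :
    q n z ∈ dualCone (wsosCone n) := by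
  rw [mem_dualCone_wsosCone_iff]
  intro i r hr
  rw [momentFun_q (weight_mul_mul_mem hr hr), eval_mul, eval_mul]
  exact mul_nonneg (weight_eval_nonneg n i hz) (mul_self_nonneg _)

theorem smul_mem_dualCone {ι : Type*} [Fintype ι] {K : Set (ι → ℝ)} {v : ι → ℝ} {c : ℝ}
    (hc : 0 ≤ c) (hv : v ∈ dualCone K) : c • v ∈ dualCone K := fun x hx => by
  rw [dotProduct_smul]; exact mul_nonneg hc (hv x hx)

theorem sum_mem_dualCone {ι κ : Type*} [Fintype ι] {K : Set (ι → ℝ)} (s : Finset κ)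
    {v : κ → ι → ℝ} (hv : ∀ k ∈ s, v k ∈ dualCone K) : ∑ k ∈ s, v k ∈ dualCone K := fun x hx => by
  rw [dotProduct_sum]; exact Finset.sum_nonneg fun k hk => hv k hk x hx

theorem isClosed_dualCone {ι : Type*} [Fintype ι] (K : Set (ι → ℝ)) : IsClosed (dualCone K) := by
  have : dualCone K = ⋂ x ∈ K, {y | 0 ≤ x ⬝ᵥ y} := by ext; simp [dualCone]
  rw [this]
  refine isClosed_biInter fun x _ => isClosed_le continuous_const ?_
  exact continuous_const.dotProduct continuous_id

theorem dotProduct_nonneg_of_mem_closure {ι : Type*} [Fintype ι] {K : Set (ι → ℝ)} {x y : ι → ℝ}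
    (hx : x ∈ closure K) (hy : y ∈ dualCone K) : 0 ≤ x ⬝ᵥ y := by
  have : closure K ⊆ {x | 0 ≤ x ⬝ᵥ y} :=
    closure_minimal (fun z hz => hy z hz)
      (isClosed_le continuous_const (continuous_id.dotProduct continuous_const))
  exact this hx

theorem U_sq_add_U_sq (m : ℤ) :
    Chebyshev.U ℝ m ^ 2 + Chebyshev.U ℝ (m - 1) ^ 2 -
      2 * X * Chebyshev.U ℝ m * Chebyshev.U ℝ (m - 1) = 1 := by
  have h := congrArg (fun p => p.comp (2 * X)) (Chebyshev.S_sq_add_S_sq ℝ (m - 1))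
  simp [Chebyshev.S_comp_two_mul_X] at h
  linear_combination h

theorem one_add_T_two_mul (m : ℤ) : 1 + Chebyshev.T ℝ (2 * m) = 2 * Chebyshev.T ℝ m ^ 2 := by
  have h := Chebyshev.T_mul_T ℝ m m
  rw [sub_self, Chebyshev.T_zero, ← two_mul] at h
  linear_combination -h

theorem one_sub_T_two_mul (m : ℤ) :
    1 - Chebyshev.T ℝ (2 * m) = 2 * ((1 - X ^ 2) * Chebyshev.U ℝ (m - 1) ^ 2) := by
  have h1 := one_add_T_two_mul m
  have h2 := U_sq_add_U_sq m
  rw [Chebyshev.T_eq_U_sub_X_mul_U ℝ m] at h1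
  linear_combination -h1 - 2 * h2

/-- At `X = cos θ`: `cos((2m+1)θ) = cos θ - 2 sin((m+1)θ) sin(mθ)`. -/
theorem T_two_mul_add_one (m : ℤ) :
    Chebyshev.T ℝ (2 * m + 1) =
      X - 2 * (1 - X ^ 2) * Chebyshev.U ℝ m * Chebyshev.U ℝ (m - 1) := by
  have h := Chebyshev.T_mul_T ℝ m (m + 1)
  have h2 := U_sq_add_U_sq m
  rw [show m - (m + 1) = -1 by ring, Chebyshev.T_neg_one, show m + (m + 1) = 2 * m + 1 by ring,
    Chebyshev.T_eq_U_sub_X_mul_U ℝ (m + 1), Chebyshev.T_eq_U_sub_X_mul_U ℝ m,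
    show m + 1 - 1 = m by ring, Chebyshev.U_add_one] at h
  linear_combination -h + 2 * X * h2

theorem one_add_T_two_mul_add_one (m : ℤ) :
    1 + Chebyshev.T ℝ (2 * m + 1) =
      (1 + X) * (Chebyshev.U ℝ m - Chebyshev.U ℝ (m - 1)) ^ 2 := by
  rw [T_two_mul_add_one]
  linear_combination -(1 + X) * U_sq_add_U_sq m

theorem one_sub_T_two_mul_add_one (m : ℤ) :
    1 - Chebyshev.T ℝ (2 * m + 1) =
      (1 - X) * (Chebyshev.U ℝ m + Chebyshev.U ℝ (m - 1)) ^ 2 := by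
  rw [T_two_mul_add_one]
  linear_combination -(1 - X) * U_sq_add_U_sq m

theorem T_mem_degreeLT {m L : ℕ} (h : m < L) : Chebyshev.T ℝ m ∈ degreeLT ℝ L := by
  rw [mem_degreeLT, Chebyshev.degree_T]
  simpa using h

theorem U_mem_degreeLT {m L : ℕ} (h : m < L) : Chebyshev.U ℝ m ∈ degreeLT ℝ L := by
  rw [mem_degreeLT, Chebyshev.degree_U_natCast]
  exact_mod_cast h

theorem U_sub_one_mem_degreeLT {m L : ℕ} (h : m ≤ L) :
    Chebyshev.U ℝ ((m : ℤ) - 1) ∈ degreeLT ℝ L := by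
  rcases m with _ | m
  · simp
  · simpa using U_mem_degreeLT h

theorem one_add_X_mul_mem_degreeLT {L : ℕ} {r : ℝ[X]} (h : r ∈ degreeLT ℝ L) :
    (1 + X) * r ∈ degreeLT ℝ (L + 1) := by
  rcases eq_or_ne r 0 with rfl | hr0
  · simp
  have h1 : r.natDegree < L := (natDegree_lt_iff_degree_lt hr0).2 (mem_degreeLT.1 h)
  have h2 : (1 + X : ℝ[X]).natDegree ≤ 1 := by compute_degree
  have h3 : ((1 + X) * r).natDegree ≤ (1 + X : ℝ[X]).natDegree + r.natDegree := natDegree_mul_le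
  rw [mem_degreeLT]
  refine degree_le_natDegree.trans_lt ?_
  exact_mod_cast (by omega : ((1 + X) * r).natDegree < L + 1)

theorem one_sub_X_mul_mem_degreeLT {L : ℕ} {r : ℝ[X]} (h : r ∈ degreeLT ℝ L) :
    (1 - X) * r ∈ degreeLT ℝ (L + 1) := by
  have h1 : 2 * r ∈ degreeLT ℝ (L + 1) := by
    rw [two_mul]
    exact add_mem (degreeLT_mono (Nat.le_succ L) h) (degreeLT_mono (Nat.le_succ L) h)
  have h2 := sub_mem h1 (one_add_X_mul_mem_degreeLT h)
  rwa [show 2 * r - (1 + X) * r = (1 - X) * r by ring] at h2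

theorem half_nonneg_of_add {L : ℝ[X] →ₗ[ℝ] ℝ} {p r s : ℝ[X]} (hr : 0 ≤ L r) (hs : 0 ≤ L s)
    (h : 2 * p = r + s) : 0 ≤ L p := by
  have := congrArg L h
  rw [two_mul, map_add, map_add] at this
  linarith

/-- If `l` and `n` have the same parity, the half-angle identities already carry the right weights.
Otherwise the weights are converted, at the price of one degree in some of the squares. -/
theorem momentFun_one_add_T_nonneg {n : ℕ} {v : Fin (n + 1) → ℝ}
    (hv : v ∈ dualCone (wsosCone n)) {l : ℕ} (hl : l ≤ n) :
    0 ≤ momentFun n v (1 + Chebyshev.T ℝ l) ∧ 0 ≤ momentFun n v (1 - Chebyshev.T ℝ l) := by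
  rw [mem_dualCone_wsosCone_iff] at hv
  have h0 := hv 0
  have h1 := hv 1
  by_cases hn : Even n
  · obtain ⟨d, rfl⟩ := hn
    have b0 : blockSize (d + d) 0 = d + 1 := by simp [blockSize]; omega
    have b1 : blockSize (d + d) 1 = d := by simp [blockSize]; omega
    rw [b0] at h0
    rw [b1] at h1
    rw [weight_even ⟨d, rfl⟩] at h0 h1
    simp only [Matrix.cons_val_zero, Matrix.cons_val_one, one_mul] at h0 h1
    obtain ⟨m, rfl | rfl⟩ := Nat.even_or_odd' l
    · push_cast
      rw [one_add_T_two_mul, one_sub_T_two_mul, two_mul, two_mul, map_add, map_add,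
        pow_two (Chebyshev.T ℝ (m : ℤ)), pow_two (Chebyshev.U ℝ ((m : ℤ) - 1))]
      have e0 := h0 _ (T_mem_degreeLT (show m < d + 1 by omega))
      have e1 := h1 _ (U_sub_one_mem_degreeLT (show m ≤ d by omega))
      exact ⟨add_nonneg e0 e0, add_nonneg e1 e1⟩
    · push_cast
      rw [one_add_T_two_mul_add_one, one_sub_T_two_mul_add_one]
      have hU : Chebyshev.U ℝ m ∈ degreeLT ℝ d := U_mem_degreeLT (by omega)
      have hU' : Chebyshev.U ℝ ((m : ℤ) - 1) ∈ degreeLT ℝ d := U_sub_one_mem_degreeLT (by omega)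
      -- Uses `2(1 ± X)r² = ((1 ± X)r)² + (1 - X²)r²`.
      have e0 := h0 _ (one_add_X_mul_mem_degreeLT (sub_mem hU hU'))
      have e1 := h1 _ (sub_mem hU hU')
      have e2 := h0 _ (one_sub_X_mul_mem_degreeLT (add_mem hU hU'))
      have e3 := h1 _ (add_mem hU hU')
      exact ⟨half_nonneg_of_add e0 e1 (by ring), half_nonneg_of_add e2 e3 (by ring)⟩
  · have hn' := hn
    rw [Nat.not_even_iff_odd] at hn'
    obtain ⟨d, rfl⟩ := hn'
    have b0 : blockSize (2 * d + 1) 0 = d + 1 := by simp [blockSize]; omega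
    have b1 : blockSize (2 * d + 1) 1 = d + 1 := by simp [blockSize]; omega
    rw [b0] at h0
    rw [b1] at h1
    rw [weight_odd hn] at h0 h1
    simp only [Matrix.cons_val_zero, Matrix.cons_val_one] at h0 h1
    obtain ⟨m, rfl | rfl⟩ := Nat.even_or_odd' l
    · push_cast
      rw [one_add_T_two_mul, one_sub_T_two_mul]
      have hT : Chebyshev.T ℝ m ∈ degreeLT ℝ (d + 1) := T_mem_degreeLT (by omega)
      have hU' : Chebyshev.U ℝ ((m : ℤ) - 1) ∈ degreeLT ℝ d := U_sub_one_mem_degreeLT (by omega)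
      have e0 := h0 _ hT
      have e1 := h1 _ hT
      have e2 := h0 _ (one_add_X_mul_mem_degreeLT hU')
      have e3 := h1 _ (one_sub_X_mul_mem_degreeLT hU')
      rw [show 2 * Chebyshev.T ℝ m ^ 2 = (1 - X) * (Chebyshev.T ℝ m * Chebyshev.T ℝ m) +
        (1 + X) * (Chebyshev.T ℝ m * Chebyshev.T ℝ m) by ring, map_add]
      rw [show 2 * ((1 - X ^ 2) * Chebyshev.U ℝ ((m : ℤ) - 1) ^ 2) =
        (1 - X) * ((1 + X) * Chebyshev.U ℝ ((m : ℤ) - 1) * ((1 + X) * Chebyshev.U ℝ ((m : ℤ) - 1))) +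
        (1 + X) * ((1 - X) * Chebyshev.U ℝ ((m : ℤ) - 1) * ((1 - X) * Chebyshev.U ℝ ((m : ℤ) - 1)))
          by ring, map_add]
      exact ⟨add_nonneg e0 e1, add_nonneg e2 e3⟩
    · push_cast
      rw [one_add_T_two_mul_add_one, one_sub_T_two_mul_add_one, sq, sq]
      have hU : Chebyshev.U ℝ m ∈ degreeLT ℝ (d + 1) := U_mem_degreeLT (by omega)
      have hU' : Chebyshev.U ℝ ((m : ℤ) - 1) ∈ degreeLT ℝ (d + 1) :=
        U_sub_one_mem_degreeLT (by omega)
      exact ⟨h1 _ (sub_mem hU hU'), h0 _ (add_mem hU hU')⟩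

theorem abs_le_apply_zero {n : ℕ} {v : Fin (n + 1) → ℝ} (hv : v ∈ dualCone (wsosCone n))
    (l : Fin (n + 1)) : |v l| ≤ v 0 := by
  obtain ⟨h1, h2⟩ := momentFun_one_add_T_nonneg hv (Nat.lt_succ_iff.1 l.2)
  have h0 : momentFun n v 1 = v 0 := by
    simpa using momentFun_T n v 0
  rw [map_add, h0, momentFun_T] at h1
  rw [map_sub, h0, momentFun_T] at h2
  exact abs_le.2 ⟨by linarith, by linarith⟩

theorem norm_eq_apply_zero {n : ℕ} {v : Fin (n + 1) → ℝ} (hv : v ∈ dualCone (wsosCone n)) :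
    ‖v‖ = v 0 := by
  have h0 : 0 ≤ v 0 := (abs_nonneg _).trans (abs_le_apply_zero hv 0)
  refine le_antisymm ((pi_norm_le_iff_of_nonneg h0).2 fun l => abs_le_apply_zero hv l) ?_
  exact (le_abs_self _).trans (norm_le_pi_norm v 0)

theorem oneVec_dotProduct {n : ℕ} (v : Fin (n + 1) → ℝ) : oneVec n ⬝ᵥ v = v 0 := by
  simp [oneVec]

theorem k1Set_oneVec (n : ℕ) : k1Set n (oneVec n) = {1} := by
  ext a
  simp only [k1Set, Set.mem_ofPred_eq, Set.mem_singleton_iff, oneVec_dotProduct]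
  constructor
  · rintro ⟨v, hv, h1, rfl⟩
    rw [← norm_eq_apply_zero hv, h1]
  · rintro rfl
    have hq := q_mem_dualCone n (z := 1) (by simp)
    refine ⟨q n 1, hq, ?_, ?_⟩
    · rw [norm_eq_apply_zero hq]; simp [q]
    · simp [q]

theorem isLeast_k1 (n : ℕ) :
    IsLeast (k1Set n (oneVec n)) (k1 n (oneVec n)) ∧ 1 ≤ k1 n (oneVec n) := by
  rw [k1, k1Set_oneVec, csInf_singleton]
  exact ⟨isLeast_singleton, le_rfl⟩

end Cone

/-! ### Discrete orthogonality at the Chebyshev nodes -/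

section Lobatto

/-- The weights of the trapezoidal rule on `n + 1` nodes. -/
noncomputable def trapWeight (n : ℕ) (l : Fin (n + 1)) : ℝ :=
  if n = 0 then 1 else if (l : ℕ) = 0 ∨ (l : ℕ) = n then 1 / 2 else 1

theorem trapWeight_pos (n : ℕ) (l : Fin (n + 1)) : 0 < trapWeight n l := by
  unfold trapWeight
  split_ifs <;> norm_num

theorem sum_trapWeight_mul {n : ℕ} (hn : n ≠ 0) (f : ℕ → ℝ) :
    ∑ l : Fin (n + 1), trapWeight n l * f l =
      ∑ l ∈ Finset.range n, (f l + f (l + 1)) / 2 := by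
  obtain ⟨m, rfl⟩ := Nat.exists_eq_succ_of_ne_zero hn
  rw [← Finset.sum_div, Finset.sum_add_distrib, Fin.sum_univ_castSucc, Fin.sum_univ_succ,
    Finset.sum_range_succ', Finset.sum_range_succ (fun l => f (l + 1))]
  have h : ∀ i : Fin m, trapWeight (m + 1) (Fin.castSucc i.succ) = 1 := by
    intro i
    simp [trapWeight, i.2.ne]
  simp only [h]
  simp [trapWeight, Finset.sum_range (fun l => f (l + 1))]
  ring

theorem sum_trapWeight_mul_cos {n : ℕ} (hn : n ≠ 0) {k : ℤ} (hk0 : 0 < k) (hk : k < 2 * n) :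
    ∑ l : Fin (n + 1), trapWeight n l * Real.cos (k * (l * Real.pi / n)) = 0 := by
  have hn' : (0 : ℝ) < n := by exact_mod_cast Nat.pos_of_ne_zero hn
  have hkr : (0 : ℝ) < k := by exact_mod_cast hk0
  have hkr2 : (k : ℝ) < 2 * n := by exact_mod_cast hk
  have hpi := Real.pi_pos
  rw [sum_trapWeight_mul hn fun l => Real.cos (k * (l * Real.pi / n))]
  have hs : 0 < Real.sin (k * Real.pi / n / 2) := by
    apply Real.sin_pos_of_pos_of_lt_pi (by positivity)
    rw [div_div, div_lt_iff₀ (by positivity)]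
    nlinarith
  -- Multiplying by twice the sine of the half step makes the sum telescope. At `N = n` the right
  -- side contains `sin(kπ) = 0`, while `0 < k < 2n` keeps the factor positive.
  have key : ∀ N : ℕ, 2 * Real.sin (k * Real.pi / n / 2) *
      ∑ l ∈ Finset.range N, (Real.cos (k * (l * Real.pi / n)) +
        Real.cos (k * ((l + 1 : ℕ) * Real.pi / n))) / 2 =
      Real.cos (k * Real.pi / n / 2) * Real.sin (N * (k * Real.pi / n)) := by
    intro N
    induction N with
    | zero => simp
    | succ N ih =>
      rw [Finset.sum_range_succ, mul_add, ih]
      have e1 : (k : ℝ) * (N * Real.pi / n) = N * (k * Real.pi / n) := by ring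
      have e2 : (k : ℝ) * ((N + 1 : ℕ) * Real.pi / n) =
          N * (k * Real.pi / n) + 2 * (k * Real.pi / n / 2) := by push_cast; ring
      have e3 : ((N + 1 : ℕ) : ℝ) * (k * Real.pi / n) =
          N * (k * Real.pi / n) + 2 * (k * Real.pi / n / 2) := by push_cast; ring
      rw [e1, e2, e3, Real.cos_add, Real.sin_add, Real.sin_two_mul, Real.cos_two_mul]
      have := Real.sin_sq_add_cos_sq (k * Real.pi / n / 2)
      generalize Real.sin (k * Real.pi / n / 2) = a at *
      generalize Real.cos (k * Real.pi / n / 2) = b at *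
      linear_combination (-2 * b * Real.sin (N * (k * Real.pi / n))) * this
  have h := key n
  rw [show (n : ℝ) * (k * Real.pi / n) = k * Real.pi by field_simp, Real.sin_int_mul_pi,
    mul_zero] at h
  exact (mul_eq_zero.1 h).resolve_left (by positivity)

theorem matM_apply (n : ℕ) {κ : Type*} [Fintype κ] (α z : κ → ℝ) (i j : Fin (n + 1)) :
    matM n α z i j = ∑ k, α k * (q n (z k) i * q n (z k) j) := by
  simp [matM, Matrix.sum_apply, vecMulVec_apply]

theorem q_chebNode (n : ℕ) (l i : Fin (n + 1)) :
    q n (chebNode n l) i = Real.cos (i * (l * Real.pi / n)) := by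
  rw [q, chebNode, Chebyshev.node, Chebyshev.T_real_cos]
  simp

/-- The diagonal of the Gram matrix of the Chebyshev polynomials for the trapezoidal rule at the
Chebyshev nodes of the second kind. -/
noncomputable def lobattoDiag (n : ℕ) (i : Fin (n + 1)) : ℝ :=
  if n = 0 then 1 else if (i : ℕ) = 0 ∨ (i : ℕ) = n then n else n / 2

theorem matM_trapWeight (n : ℕ) :
    matM n (trapWeight n) (chebNode n) = diagonal (lobattoDiag n) := by
  ext i j
  rw [matM_apply]
  rcases eq_or_ne n 0 with rfl | hn
  · obtain rfl : i = 0 := Fin.ext (by omega)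
    obtain rfl : j = 0 := Fin.ext (by omega)
    simp [trapWeight, lobattoDiag, q]
  have hn0 : 0 < n := Nat.pos_of_ne_zero hn
  have h1 : ∀ l : Fin (n + 1), trapWeight n l * (q n (chebNode n l) i * q n (chebNode n l) j) =
      (trapWeight n l * Real.cos (((i + j : ℤ) : ℝ) * (l * Real.pi / n)) +
        trapWeight n l * Real.cos (((i - j : ℤ) : ℝ) * (l * Real.pi / n))) / 2 := by
    intro l
    rw [q_chebNode, q_chebNode]
    push_cast
    rw [add_mul, sub_mul, Real.cos_add, Real.cos_sub]
    ring
  rw [Finset.sum_congr rfl fun l _ => h1 l, ← Finset.sum_div, Finset.sum_add_distrib]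
  have hi := Nat.lt_succ_iff.1 i.2
  have hj := Nat.lt_succ_iff.1 j.2
  have hone : ∑ l : Fin (n + 1), trapWeight n l = n := by
    have := sum_trapWeight_mul hn fun _ => 1
    simpa using this
  rcases eq_or_ne i j with rfl | hij
  · rw [diagonal_apply_eq]
    simp only [sub_self, Int.cast_zero, zero_mul, Real.cos_zero, mul_one, hone, lobattoDiag, if_neg hn]
    by_cases hi0 : (i : ℕ) = 0
    · simp [hi0, hone]
    by_cases hin : (i : ℕ) = n
    -- For `i = j = n` the frequency `2n` aliases to the constant `1` on the nodes.
    · have : ∀ l : Fin (n + 1), Real.cos (((i + i : ℤ) : ℝ) * (l * Real.pi / n)) = 1 := by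
        intro l
        have hn' : (n : ℝ) ≠ 0 := by exact_mod_cast hn
        rw [hin]
        push_cast
        rw [show ((n : ℝ) + n) * (l * Real.pi / n) = ((l : ℕ) : ℝ) * (2 * Real.pi) by
          field_simp; ring, Real.cos_nat_mul_two_pi]
      rw [Finset.sum_congr rfl fun l _ => by rw [this l, mul_one], hone, if_pos (Or.inr hin)]
      ring
    · rw [sum_trapWeight_mul_cos hn (by omega) (by omega)]
      simp [hi0, hin]
  · rw [diagonal_apply_ne _ hij]
    have hij' : (i : ℕ) ≠ j := fun h => hij (Fin.ext h)
    rw [sum_trapWeight_mul_cos hn (by omega) (by omega)]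
    rcases lt_or_gt_of_ne hij' with h | h
    · have h2 : ∀ l : Fin (n + 1), Real.cos (((i - j : ℤ) : ℝ) * (l * Real.pi / n)) =
          Real.cos (((j - i : ℤ) : ℝ) * (l * Real.pi / n)) := by
        intro l
        rw [← Real.cos_neg]
        congr 1
        push_cast
        ring
      simp only [h2]
      rw [sum_trapWeight_mul_cos hn (by omega) (by omega)]
      simp
    · rw [sum_trapWeight_mul_cos hn (by omega) (by omega)]
      simp

theorem exists_lobattoDiag_bounds (n : ℕ) :
    ∃ m : ℝ, 0 < m ∧ ∀ i, m ≤ lobattoDiag n i ∧ lobattoDiag n i ≤ 2 * m := by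
  rcases eq_or_ne n 0 with rfl | hn
  · exact ⟨1, one_pos, fun i => by simp [lobattoDiag]⟩
  · have hn' : (0 : ℝ) < n := by exact_mod_cast Nat.pos_of_ne_zero hn
    refine ⟨n / 2, by positivity, fun i => ?_⟩
    rw [lobattoDiag, if_neg hn]
    split_ifs <;> constructor <;> linarith

theorem lobattoDiag_pos (n : ℕ) (i : Fin (n + 1)) : 0 < lobattoDiag n i := by
  obtain ⟨m, hm, h⟩ := exists_lobattoDiag_bounds n
  exact hm.trans_le (h i).1

theorem chebNode_mem_Icc (n : ℕ) (l : Fin (n + 1)) : chebNode n l ∈ Set.Icc (-1 : ℝ) 1 :=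
  Chebyshev.node_mem_Icc

theorem chebNode_injective (n : ℕ) : Function.Injective (chebNode n) := by
  intro i j h
  exact Fin.ext ((Chebyshev.strictAntiOn_node n).injOn (by simpa using Nat.lt_succ_iff.1 i.2)
    (by simpa using Nat.lt_succ_iff.1 j.2) h)

theorem eq_of_eval_eq {n : ℕ} {z : Fin (n + 1) → ℝ} (hz : Function.Injective z) {p r : ℝ[X]}
    (hp : p ∈ degreeLT ℝ (n + 1)) (hr : r ∈ degreeLT ℝ (n + 1))
    (h : ∀ i, p.eval (z i) = r.eval (z i)) : p = r := by
  refine Polynomial.eq_of_degrees_lt_of_eval_index_eq Finset.univ hz.injOn ?_ ?_ fun i _ => h i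
  · simpa using mem_degreeLT.1 hp
  · simpa using mem_degreeLT.1 hr

theorem unisolvent_chebNode (n : ℕ) : Unisolvent n (chebNode n) := fun _ hp _ hr h =>
  eq_of_eval_eq (chebNode_injective n) hp hr h

theorem exists_condNumber_le (n : ℕ) :
    ∃ α : Fin (n + 1) → ℝ, (∀ l, 0 < α l) ∧
      (matM n α (chebNode n)).PosDef ∧ condNumber (matM n α (chebNode n)) ≤ 4 := by
  refine ⟨trapWeight n, trapWeight_pos n, ?_, ?_⟩
  · rw [matM_trapWeight]
    exact posDef_diagonal_iff.2 (lobattoDiag_pos n)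
  · obtain ⟨m, hm, h⟩ := exists_lobattoDiag_bounds n
    rw [condNumber, matM_trapWeight, spectrum_diagonal]
    have h1 : sSup (Set.range (lobattoDiag n)) ≤ 2 * m :=
      csSup_le (Set.range_nonempty _) (by rintro _ ⟨i, rfl⟩; exact (h i).2)
    have h2 : m ≤ sInf (Set.range (lobattoDiag n)) :=
      le_csInf (Set.range_nonempty _) (by rintro _ ⟨i, rfl⟩; exact (h i).1)
    rw [div_le_iff₀ (hm.trans_le h2)]
    linarith

/-- Every vector is a combination of point evaluations at the Chebyshev nodes. -/
theorem exists_eq_sum_q (n : ℕ) (h : Fin (n + 1) → ℝ) :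
    ∃ c : Fin (n + 1) → ℝ, h = ∑ k, c k • q n (chebNode n k) ∧
      (∑ k, |c k| • q n (chebNode n k)) ⬝ᵥ (∑ k, |c k| • q n (chebNode n k)) ≤ 2 * (h ⬝ᵥ h) := by
  obtain ⟨m, hm, hd⟩ := exists_lobattoDiag_bounds n
  have hdp := lobattoDiag_pos n
  have hM : ∀ u i, ∑ k, trapWeight n k * ((q n (chebNode n k) ⬝ᵥ u) * q n (chebNode n k) i) =
      lobattoDiag n i * u i := by
    intro u i
    have h1 := congrFun (congrArg (· *ᵥ u) (matM_trapWeight n)) i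
    simp only [mulVec_diagonal] at h1
    rw [← h1]
    simp only [mulVec, dotProduct, matM_apply, Finset.sum_mul, Finset.mul_sum]
    rw [Finset.sum_comm]
    exact Finset.sum_congr rfl fun k _ => Finset.sum_congr rfl fun j _ => by ring
  have hMM : ∀ u : Fin (n + 1) → ℝ, ∑ k, trapWeight n k * (q n (chebNode n k) ⬝ᵥ u) ^ 2 =
      ∑ i, lobattoDiag n i * u i ^ 2 := by
    intro u
    have h1 : ∀ i, lobattoDiag n i * u i ^ 2 =
        ∑ k, trapWeight n k * ((q n (chebNode n k) ⬝ᵥ u) * q n (chebNode n k) i) * u i := by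
      intro i
      rw [← Finset.sum_mul, hM]
      ring
    simp only [h1]
    rw [Finset.sum_comm]
    refine Finset.sum_congr rfl fun k _ => ?_
    rw [sq]
    nth_rw 2 [dotProduct]
    rw [Finset.mul_sum, Finset.mul_sum]
    exact Finset.sum_congr rfl fun j _ => by ring
  -- Since `M = ∑ α_k q_k q_kᵀ` is diagonal, `h = M u = ∑ α_k (q_kᵀu) q_k`.
  set u : Fin (n + 1) → ℝ := fun i => h i / lobattoDiag n i with hu
  refine ⟨fun k => trapWeight n k * (q n (chebNode n k) ⬝ᵥ u), ?_, ?_⟩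
  · ext i
    rw [Finset.sum_apply]
    simp only [Pi.smul_apply, smul_eq_mul, mul_assoc]
    rw [hM, hu]
    field_simp [(hdp i).ne']
  set g : Fin (n + 1) → ℝ :=
    ∑ k, |trapWeight n k * (q n (chebNode n k) ⬝ᵥ u)| • q n (chebNode n k) with hg
  have hgg : g ⬝ᵥ g = ∑ k, (√(trapWeight n k) * |q n (chebNode n k) ⬝ᵥ u|) *
      (√(trapWeight n k) * (q n (chebNode n k) ⬝ᵥ g)) := by
    conv_lhs => rw [hg, sum_dotProduct]
    refine Finset.sum_congr rfl fun k _ => ?_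
    rw [smul_dotProduct, abs_mul, abs_of_pos (trapWeight_pos n k), smul_eq_mul]
    have := Real.mul_self_sqrt (trapWeight_pos n k).le
    linear_combination (-(|q n (chebNode n k) ⬝ᵥ u| * (q n (chebNode n k) ⬝ᵥ g))) * this
  -- Cauchy–Schwarz for the quadrature weights. With `m ≤ M ≤ 2m`, the factors are at most `hᵀh / m`
  -- and `2m gᵀg`, whence the constant `2`.
  have hcs : (g ⬝ᵥ g) ^ 2 ≤ (∑ i, lobattoDiag n i * u i ^ 2) * ∑ i, lobattoDiag n i * g i ^ 2 := by
    rw [hgg, ← hMM, ← hMM]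
    refine (Finset.sum_mul_sq_le_sq_mul_sq _ _ _).trans_eq ?_
    congr 1 <;> refine Finset.sum_congr rfl fun k _ => ?_
    · rw [mul_pow, sq_abs, Real.sq_sqrt (trapWeight_pos n k).le]
    · rw [mul_pow, Real.sq_sqrt (trapWeight_pos n k).le]
  have h1 : m * ∑ i, lobattoDiag n i * u i ^ 2 ≤ h ⬝ᵥ h := by
    rw [Finset.mul_sum, dotProduct]
    refine Finset.sum_le_sum fun i _ => ?_
    have e : h i = lobattoDiag n i * u i := by rw [hu]; field_simp [(hdp i).ne']
    rw [e]
    have := mul_le_mul_of_nonneg_right (hd i).1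
      (mul_nonneg (hdp i).le (sq_nonneg (u i)))
    linarith
  have h2 : ∑ i, lobattoDiag n i * g i ^ 2 ≤ 2 * m * (g ⬝ᵥ g) := by
    rw [dotProduct, Finset.mul_sum]
    refine Finset.sum_le_sum fun i _ => ?_
    have := mul_le_mul_of_nonneg_right (hd i).2 (sq_nonneg (g i))
    linarith
  have h0 : 0 ≤ ∑ i, lobattoDiag n i * u i ^ 2 :=
    Finset.sum_nonneg fun i _ => mul_nonneg (hdp i).le (sq_nonneg _)
  have hg0 : 0 ≤ g ⬝ᵥ g := by simpa using dotProduct_star_self_nonneg g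
  rcases hg0.eq_or_lt with hz | hpos
  · rw [← hz]
    have : 0 ≤ h ⬝ᵥ h := by simpa using dotProduct_star_self_nonneg h
    linarith
  · have h3 : (g ⬝ᵥ g) ^ 2 ≤ 2 * (h ⬝ᵥ h) * (g ⬝ᵥ g) := by
      refine hcs.trans ((mul_le_mul_of_nonneg_left h2 h0).trans ?_)
      nlinarith
    nlinarith

/-- As `T_0 = 1`, the zeroth column of `M` is `∑ α_k q(z_k)`, and it is a positive multiple of
`oneVec`. -/
theorem oneVec_mem_dualCone (n : ℕ) : oneVec n ∈ dualCone (wsosCone n) := by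
  have h : oneVec n = (lobattoDiag n 0)⁻¹ • ∑ k, trapWeight n k • q n (chebNode n k) := by
    ext i
    have h1 := congrFun (congrFun (matM_trapWeight n) i) 0
    rw [matM_apply] at h1
    have h2 : ∀ z, q n z 0 = 1 := fun z => by simp [q]
    simp only [h2, mul_one] at h1
    rw [Pi.smul_apply, Finset.sum_apply]
    simp only [Pi.smul_apply, smul_eq_mul, h1]
    have := (lobattoDiag_pos n 0).ne'
    rcases eq_or_ne i 0 with rfl | hi
    · simp [oneVec, this]
    · simp [oneVec, hi]
  rw [h]
  refine smul_mem_dualCone (inv_nonneg.2 (lobattoDiag_pos n 0).le) (sum_mem_dualCone _ fun k _ => ?_)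
  exact smul_mem_dualCone (trapWeight_pos n k).le (q_mem_dualCone n (chebNode_mem_Icc n k))

end Lobatto

/-! ### The map `Λ` and positive semidefiniteness -/

section LambdaMap

variable {n : ℕ} (p : PBases n)

theorem LamBlock_apply (i : Fin 2) (v : Fin (n + 1) → ℝ) (j k : Fin (blockSize n i)) :
    LamBlock n p i v j k = momentFun n v (weight n i * ((p i j : ℝ[X]) * (p i k : ℝ[X]))) := by
  rw [LamBlock, Matrix.of_apply, momentFun_apply, mul_assoc]

theorem Lam_add (v w : Fin (n + 1) → ℝ) : Lam n p (v + w) = Lam n p v + Lam n p w := by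
  rw [Lam, Lam, Lam, ← blockDiagonal'_add]
  congr 1
  ext i j k
  simp [LamBlock_apply, momentFun_add]

theorem Lam_smul (c : ℝ) (v : Fin (n + 1) → ℝ) : Lam n p (c • v) = c • Lam n p v := by
  rw [Lam, Lam, ← blockDiagonal'_smul]
  congr 1
  ext i j k
  simp [LamBlock_apply, momentFun_smul]

/-- The map `Λ` as a linear map. -/
noncomputable def LamLin : (Fin (n + 1) → ℝ) →ₗ[ℝ]
    Matrix ((i : Fin 2) × Fin (blockSize n i)) ((i : Fin 2) × Fin (blockSize n i)) ℝ where
  toFun := Lam n p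
  map_add' := Lam_add p
  map_smul' := Lam_smul p

theorem LamLin_apply (v : Fin (n + 1) → ℝ) : LamLin p v = Lam n p v := rfl

theorem Lam_sub (v w : Fin (n + 1) → ℝ) : Lam n p (v - w) = Lam n p v - Lam n p w :=
  map_sub (LamLin p) v w

theorem Lam_isSymm (v : Fin (n + 1) → ℝ) : (Lam n p v).IsSymm := by
  rw [Matrix.IsSymm, Lam, blockDiagonal'_transpose]
  congr 1
  ext i j k
  simp [LamBlock_apply, mul_comm]

/-- The polynomial in block `i` with coefficient vector `c`. -/
noncomputable def blockPoly (c : ((i : Fin 2) × Fin (blockSize n i)) → ℝ) (i : Fin 2) :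
    degreeLT ℝ (blockSize n i) := ∑ j, c ⟨i, j⟩ • p i j

theorem blockPoly_eq_zero {c : ((i : Fin 2) × Fin (blockSize n i)) → ℝ}
    (h : ∀ i, blockPoly p c i = 0) : c = 0 := by
  ext ⟨i, j⟩
  exact Fintype.linearIndependent_iff.1 (p i).linearIndependent (fun j => c ⟨i, j⟩) (h i) j

theorem dotProduct_Lam_mulVec (v : Fin (n + 1) → ℝ)
    (c : ((i : Fin 2) × Fin (blockSize n i)) → ℝ) :
    c ⬝ᵥ Lam n p v *ᵥ c = ∑ i, momentFun n v
      (weight n i * ((blockPoly p c i : ℝ[X]) * (blockPoly p c i : ℝ[X]))) := by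
  simp only [dotProduct, mulVec, Finset.mul_sum]
  rw [Fintype.sum_sigma]
  refine Finset.sum_congr rfl fun i _ => ?_
  have h : weight n i * ((blockPoly p c i : ℝ[X]) * (blockPoly p c i : ℝ[X])) =
      ∑ j, ∑ k, (c ⟨i, j⟩ * c ⟨i, k⟩) • (weight n i * ((p i j : ℝ[X]) * (p i k : ℝ[X]))) := by
    rw [blockPoly, Submodule.coe_sum, Finset.sum_mul_sum]
    simp only [Submodule.coe_smul, Finset.mul_sum, smul_eq_C_mul, C_mul]
    exact Finset.sum_congr rfl fun j _ => Finset.sum_congr rfl fun k _ => by ring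
  rw [h, map_sum]
  refine Finset.sum_congr rfl fun j _ => ?_
  rw [map_sum, Fintype.sum_sigma, Finset.sum_eq_single i]
  · refine Finset.sum_congr rfl fun k _ => ?_
    rw [Lam, blockDiagonal'_apply_eq, LamBlock_apply, map_smul, smul_eq_mul]
    ring
  · intro b _ hb
    refine Finset.sum_eq_zero fun k _ => ?_
    rw [Lam, blockDiagonal'_apply_ne _ _ _ hb.symm]
    ring
  · simp

theorem mem_dualCone_iff_posSemidef {v : Fin (n + 1) → ℝ} :
    v ∈ dualCone (wsosCone n) ↔ (Lam n p v).PosSemidef := by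
  rw [mem_dualCone_wsosCone_iff]
  constructor
  · intro h
    refine .of_dotProduct_mulVec_nonneg (Lam_isSymm p v) fun c => ?_
    rw [star_trivial, dotProduct_Lam_mulVec]
    exact Finset.sum_nonneg fun i _ => h i _ (blockPoly p c i).2
  · intro h i r hr
    obtain ⟨b, hb⟩ : ∃ b : Fin (blockSize n i) → ℝ, ∑ j, b j • p i j = ⟨r, hr⟩ :=
      ⟨_, (p i).sum_repr ⟨r, hr⟩⟩
    -- The coefficients of `r` in block `i`, extended by zero to the other block.
    have h1 := h.dotProduct_mulVec_nonneg fun jk => if h : jk.1 = i then b (h ▸ jk.2) else 0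
    rw [star_trivial, dotProduct_Lam_mulVec, Finset.sum_eq_single i] at h1
    · simpa [blockPoly, hb] using h1
    · intro j _ hj
      simp [blockPoly, hj]
    · simp

/-- Both `v` and `-v` lie in `Σ*`, so `v 0 = 0` dominates every coordinate. Gives invertibility of
the Hessian. -/
theorem Lam_eq_zero {v : Fin (n + 1) → ℝ} (h : Lam n p v = 0) : v = 0 := by
  have h1 : v ∈ dualCone (wsosCone n) := by
    rw [mem_dualCone_iff_posSemidef p, h]; exact .zero
  have h2 : (-1 : ℝ) • v ∈ dualCone (wsosCone n) := by
    rw [mem_dualCone_iff_posSemidef p, Lam_smul, h, smul_zero]; exact .zero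
  ext l
  have h3 := abs_le_apply_zero h1 l
  have h4 := abs_le_apply_zero h2 0
  simp only [Pi.smul_apply, smul_eq_mul] at h4
  have h5 := (abs_nonneg _).trans h4
  have h6 := abs_nonneg (v l)
  exact abs_eq_zero.1 (by linarith)

theorem continuous_Lam : Continuous (Lam n p) :=
  (LamLin p).continuous_of_finiteDimensional

/-- There is a vector at which `Λ` is positive definite: a sum of evaluations at `n + 1` points. -/
theorem exists_posDef_Lam : ∃ x, (Lam n p x).PosDef := by
  -- Distinct points of `[0, 1)`, where both weights are strictly positive.
  set z : Fin (n + 1) → ℝ := fun l => l / (n + 2) with hz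
  have hn : (0 : ℝ) < n + 2 := by positivity
  have hzm : ∀ l, z l ∈ Set.Ioo (-1 : ℝ) 1 := by
    intro l
    have h1 : (0 : ℝ) ≤ z l := by rw [hz]; positivity
    refine ⟨by linarith, ?_⟩
    rw [hz, div_lt_one hn]
    have : ((l : ℕ) : ℝ) < n + 1 := by exact_mod_cast l.2
    linarith
  have hzi : Function.Injective z := by
    intro a b h
    simp only [hz] at h
    rw [div_left_inj' hn.ne'] at h
    exact Fin.ext (by exact_mod_cast h)
  have hval : ∀ c, c ⬝ᵥ Lam n p (∑ l, q n (z l)) *ᵥ c =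
      ∑ i, ∑ l, (weight n i).eval (z l) * (blockPoly p c i : ℝ[X]).eval (z l) ^ 2 := by
    intro c
    rw [dotProduct_Lam_mulVec]
    refine Finset.sum_congr rfl fun i _ => ?_
    rw [momentFun_sum]
    refine Finset.sum_congr rfl fun l _ => ?_
    rw [momentFun_q (weight_mul_mul_mem (blockPoly p c i).2 (blockPoly p c i).2), eval_mul,
      eval_mul, sq]
  have hnn : ∀ c i l, 0 ≤ (weight n i).eval (z l) * (blockPoly p c i : ℝ[X]).eval (z l) ^ 2 :=
    fun c i l => mul_nonneg (weight_eval_pos n i (hzm l)).le (sq_nonneg _)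
  refine ⟨∑ l, q n (z l), .of_dotProduct_mulVec_pos (Lam_isSymm p _) fun c hc => ?_⟩
  rw [star_trivial]
  refine lt_of_le_of_ne ?_ fun h0 => hc (blockPoly_eq_zero p fun i => ?_)
  · rw [hval]
    exact Finset.sum_nonneg fun i _ => Finset.sum_nonneg fun l _ => hnn c i l
  · rw [hval, eq_comm, Finset.sum_eq_zero_iff_of_nonneg fun i _ =>
      Finset.sum_nonneg fun l _ => hnn c i l] at h0
    have h1 := (Finset.sum_eq_zero_iff_of_nonneg fun l _ => hnn c i l).1 (h0 i (Finset.mem_univ _))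
    have h2 : ∀ l, (blockPoly p c i : ℝ[X]).eval (z l) = 0 := by
      intro l
      have := (mul_eq_zero.1 (h1 l (Finset.mem_univ _))).resolve_left
        (weight_eval_pos n i (hzm l)).ne'
      simpa using this
    have h3 : blockSize n i ≤ n + 1 := by
      fin_cases i <;> simp [blockSize] <;> omega
    apply Subtype.ext
    refine Polynomial.eq_of_degrees_lt_of_eval_index_eq Finset.univ hzi.injOn ?_ ?_ fun l _ => ?_
    · simpa using mem_degreeLT.1 (degreeLT_mono h3 (blockPoly p c i).2)
    · simp
    · simpa using h2 l

theorem card_index (n : ℕ) : Fintype.card ((i : Fin 2) × Fin (blockSize n i)) = n + 1 := by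
  rw [Fintype.card_sigma, Fin.sum_univ_two, Fintype.card_fin, Fintype.card_fin]
  simp [blockSize]
  omega

end LambdaMap

/-! ### Gradient and Hessian of the barrier -/

section Calculus

variable {ι : Type*} [Fintype ι] [DecidableEq ι]

theorem hasDerivAt_det_line {Y K : Matrix ι ι ℝ} (hY : IsUnit Y.det) :
    HasDerivAt (fun s : ℝ => (Y + s • K).det) (Y.det * (Y⁻¹ * K).trace) 0 := by
  have h : (fun s : ℝ => (Y + s • K).det) = fun s => Y.det * (1 + (Y⁻¹ * K).trace * s +
      (det (1 + (X : ℝ[X]) • (Y⁻¹ * K).map C)).divX.divX.eval s * s ^ 2) := by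
    funext s
    rw [← det_one_add_smul, ← det_mul, Matrix.mul_add, Matrix.mul_one, Matrix.mul_smul,
      ← Matrix.mul_assoc, Matrix.mul_nonsing_inv _ hY, Matrix.one_mul]
  rw [h]
  generalize (det (1 + (X : ℝ[X]) • (Y⁻¹ * K).map C)).divX.divX = P
  have h1 : HasDerivAt (fun s : ℝ => 1 + (Y⁻¹ * K).trace * s + P.eval s * s ^ 2)
      ((Y⁻¹ * K).trace * 1 + (P.derivative.eval 0 * 0 ^ 2 + P.eval 0 * (2 * 0 ^ 1 * 1))) 0 := by
    refine (((hasDerivAt_id (0 : ℝ)).const_mul _).const_add 1).add ?_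
    exact (P.hasDerivAt 0).mul ((hasDerivAt_id (0 : ℝ)).pow 2)
  simpa using h1.const_mul Y.det

theorem hasDerivAt_trace_inv_line {Y K B : Matrix ι ι ℝ} (hY : IsUnit Y.det) :
    HasDerivAt (fun s : ℝ => ((Y + s • K)⁻¹ * B).trace) (-traceForm Y K B) 0 := by
  have hc : Continuous fun s : ℝ => Y + s • K := by fun_prop
  have hdet : ContinuousAt (fun s : ℝ => (Y + s • K).det) 0 := hc.matrix_det.continuousAt
  have hinv : ContinuousAt (fun s : ℝ => (Y + s • K)⁻¹) 0 := by
    simp only [Matrix.inv_def, Ring.inverse_eq_inv']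
    exact (hdet.inv₀ (by simpa using hY.ne_zero)).smul hc.matrix_adjugate.continuousAt
  have hev : ∀ᶠ s : ℝ in nhds 0, IsUnit (Y + s • K).det := by
    have : ∀ᶠ s : ℝ in nhds 0, (Y + s • K).det ≠ 0 :=
      hdet.eventually_ne (by simpa using hY.ne_zero)
    exact this.mono fun s hs => isUnit_iff_ne_zero.2 hs
  rw [hasDerivAt_iff_tendsto_slope]
  have hlim : Filter.Tendsto (fun s : ℝ => -((Y + s • K)⁻¹ * K * Y⁻¹ * B).trace)
      (nhds 0) (nhds (-traceForm Y K B)) := by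
    have : ContinuousAt (fun s : ℝ => -((Y + s • K)⁻¹ * K * Y⁻¹ * B).trace) 0 := by
      refine ContinuousAt.neg ?_
      have hcont : Continuous fun M : Matrix ι ι ℝ => (M * K * Y⁻¹ * B).trace := by fun_prop
      exact hcont.continuousAt.comp hinv
    have h2 := this.tendsto
    simpa [traceForm] using h2
  refine (hlim.mono_left nhdsWithin_le_nhds).congr' ?_
  filter_upwards [hev.filter_mono nhdsWithin_le_nhds, self_mem_nhdsWithin] with s hs hs0
  have hs0 : s ≠ 0 := hs0
  -- Resolvent identity.
  have e : (Y + s • K)⁻¹ - Y⁻¹ = -(s • ((Y + s • K)⁻¹ * K * Y⁻¹)) := by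
    have h1 : (Y + s • K)⁻¹ * (Y - (Y + s • K)) * Y⁻¹ = (Y + s • K)⁻¹ - Y⁻¹ := by
      rw [Matrix.mul_sub, Matrix.sub_mul, Matrix.mul_assoc, Matrix.mul_nonsing_inv _ hY,
        Matrix.nonsing_inv_mul _ hs, Matrix.mul_one, Matrix.one_mul]
    rw [← h1]
    simp
  simp only [slope_def_field, zero_smul, add_zero, sub_zero]
  rw [← trace_sub, ← Matrix.sub_mul, e]
  simp
  field_simp

theorem contDiff_det : ContDiff ℝ ⊤ fun M : ι → ι → ℝ => (Matrix.of M).det := by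
  simp only [det_apply]
  refine ContDiff.sum fun σ _ => ?_
  refine ContDiff.const_smul _ (contDiff_prod fun i _ => ?_)
  exact contDiff_apply_apply ℝ ℝ (σ i) i

variable {n : ℕ} (p : PBases n)

theorem contDiff_det_Lam : ContDiff ℝ ⊤ fun y => (Lam n p y).det := by
  have h : ContDiff ℝ ⊤ fun y => fun i j => Lam n p y i j := by
    refine contDiff_pi.2 fun i => contDiff_pi.2 fun j => ?_
    let L : (Fin (n + 1) → ℝ) →ₗ[ℝ] ℝ :=
      { toFun := fun y => Lam n p y i j
        map_add' := fun x y => by rw [Lam_add]; rfl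
        map_smul' := fun c y => by rw [Lam_smul]; rfl }
    exact L.toContinuousLinearMap.contDiff
  exact contDiff_det.comp h

theorem contDiffAt_barrier {y : Fin (n + 1) → ℝ} (hy : (Lam n p y).det ≠ 0) :
    ContDiffAt ℝ ⊤ (barrier n p) y :=
  ((contDiff_det_Lam p).contDiffAt.log hy).neg

theorem Lam_line (y k : Fin (n + 1) → ℝ) (s : ℝ) :
    Lam n p (y + s • k) = Lam n p y + s • Lam n p k := by
  rw [Lam_add, Lam_smul]

theorem hasDerivAt_line (y k : Fin (n + 1) → ℝ) : HasDerivAt (fun s : ℝ => y + s • k) k 0 := by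
  simpa using ((hasDerivAt_id (0 : ℝ)).smul_const k).const_add y

theorem fderiv_barrier_apply {y : Fin (n + 1) → ℝ} (hy : (Lam n p y).det ≠ 0)
    (k : Fin (n + 1) → ℝ) :
    fderiv ℝ (barrier n p) y k = -((Lam n p y)⁻¹ * Lam n p k).trace := by
  have h1 : HasFDerivAt (barrier n p) (fderiv ℝ (barrier n p) y) (y + (0 : ℝ) • k) := by
    simpa using ((contDiffAt_barrier p hy).differentiableAt (by simp)).hasFDerivAt
  have h2 := h1.comp_hasDerivAt (0 : ℝ) (hasDerivAt_line y k)
  have h3 := ((hasDerivAt_det_line (K := Lam n p k) (isUnit_iff_ne_zero.2 hy)).log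
    (by simpa using hy)).neg
  have h4 : (barrier n p ∘ fun s : ℝ => y + s • k) =
      -fun s : ℝ => Real.log (Lam n p y + s • Lam n p k).det := by
    funext s
    simp [barrier, Lam_line]
  rw [h4] at h2
  rw [h2.unique h3]
  simp only [zero_smul, add_zero]
  field_simp

theorem hessian_barrier_apply {y : Fin (n + 1) → ℝ} (hy : (Lam n p y).det ≠ 0)
    (i j : Fin (n + 1)) :
    hessian (barrier n p) y i j =
      traceForm (Lam n p y) (Lam n p (Pi.single i 1)) (Lam n p (Pi.single j 1)) := by
  have hd : DifferentiableAt ℝ (fun z => fderiv ℝ (barrier n p) z (Pi.single j 1)) y := by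
    have h1 : ContDiffAt ℝ 1 (fderiv ℝ (barrier n p)) y :=
      (contDiffAt_barrier p hy).fderiv_right (by simp)
    exact (h1.differentiableAt (by simp)).clm_apply (differentiableAt_const _)
  have h1 : HasFDerivAt (fun z => fderiv ℝ (barrier n p) z (Pi.single j 1))
      (fderiv ℝ (fun z => fderiv ℝ (barrier n p) z (Pi.single j 1)) y)
      (y + (0 : ℝ) • (Pi.single i 1 : Fin (n + 1) → ℝ)) := by
    simpa using hd.hasFDerivAt
  have h2 := h1.comp_hasDerivAt (0 : ℝ) (hasDerivAt_line y (Pi.single i 1))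
  have h3 := (hasDerivAt_trace_inv_line (K := Lam n p (Pi.single i 1))
    (B := Lam n p (Pi.single j 1)) (isUnit_iff_ne_zero.2 hy)).neg
  have hc : ContinuousAt (fun s : ℝ => (Lam n p (y + s • Pi.single i 1)).det) 0 := by
    have : Continuous fun s : ℝ => (Lam n p (y + s • Pi.single i 1)).det :=
      (contDiff_det_Lam p).continuous.comp (by fun_prop)
    exact this.continuousAt
  have hev : ∀ᶠ s : ℝ in nhds 0, (Lam n p (y + s • Pi.single i 1)).det ≠ 0 :=
    hc.eventually_ne (by simpa using hy)
  have h4 : (fun s : ℝ => -((Lam n p y + s • Lam n p (Pi.single i 1))⁻¹ *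
      Lam n p (Pi.single j 1)).trace) =ᶠ[nhds 0]
      ((fun z => fderiv ℝ (barrier n p) z (Pi.single j 1)) ∘
        fun s : ℝ => y + s • (Pi.single i 1 : Fin (n + 1) → ℝ)) := by
    filter_upwards [hev] with s hs
    rw [Function.comp_apply, fderiv_barrier_apply p hs, Lam_line]
  have h5 := h2.congr_of_eventuallyEq h4
  rw [hessian, Matrix.of_apply, h5.unique h3, neg_neg]

theorem Lam_eq_sum (w : Fin (n + 1) → ℝ) : Lam n p w = ∑ j, w j • Lam n p (Pi.single j 1) := by
  simp only [← LamLin_apply, ← map_smul, ← map_sum]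
  congr 1
  ext j
  simp [Finset.sum_apply, Pi.single_apply]

theorem hessian_barrier_mulVec {y : Fin (n + 1) → ℝ} (hy : (Lam n p y).det ≠ 0)
    (w k : Fin (n + 1) → ℝ) :
    k ⬝ᵥ hessian (barrier n p) y *ᵥ w = traceForm (Lam n p y) (Lam n p k) (Lam n p w) := by
  have h1 : ∀ (S : Matrix ((i : Fin 2) × Fin (blockSize n i)) _ ℝ) B,
      traceForm S (Lam n p k) B = ∑ i, k i * traceForm S (Lam n p (Pi.single i 1)) B := by
    intro S B
    rw [Lam_eq_sum p k]
    simp [traceForm, Matrix.mul_sum, Matrix.sum_mul]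
  have h2 : ∀ (S : Matrix ((i : Fin 2) × Fin (blockSize n i)) _ ℝ) A,
      traceForm S A (Lam n p w) = ∑ j, w j * traceForm S A (Lam n p (Pi.single j 1)) := by
    intro S A
    rw [Lam_eq_sum p w]
    simp [traceForm, Matrix.mul_sum]
  rw [h1, dotProduct]
  refine Finset.sum_congr rfl fun i _ => ?_
  rw [h2, mulVec, dotProduct]
  congr 1
  refine Finset.sum_congr rfl fun j _ => ?_
  rw [hessian_barrier_apply p hy, mul_comm]

theorem isUnit_det_hessian_barrier {y : Fin (n + 1) → ℝ} (hy : (Lam n p y).PosDef) :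
    IsUnit (hessian (barrier n p) y).det := by
  rw [isUnit_iff_ne_zero]
  intro h0
  obtain ⟨v, hv, hv0⟩ := Matrix.exists_mulVec_eq_zero_iff.2 h0
  refine hv (Lam_eq_zero p (traceForm_self_eq_zero hy (Lam_isSymm p v) ?_))
  rw [← hessian_barrier_mulVec p hy.det_pos.ne', hv0, dotProduct_zero]

end Calculus

/-! ### Gradient certificates, their neighbourhoods, and rounding -/

section Certificates

variable {n : ℕ} (p : PBases n)

theorem mem_interior_dualCone {y : Fin (n + 1) → ℝ} (hy : (Lam n p y).PosDef) :
    y ∈ interior (dualCone (wsosCone n)) := by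
  rw [mem_interior_iff_mem_nhds]
  have hc : Continuous fun v => traceForm (Lam n p y) (Lam n p v - Lam n p y)
      (Lam n p v - Lam n p y) := by
    have h := (continuous_Lam p).sub (continuous_const (y := Lam n p y))
    exact (((continuous_const.matrix_mul h).matrix_mul continuous_const).matrix_mul h).matrix_trace
  have h0 : ∀ᶠ v in nhds y, traceForm (Lam n p y) (Lam n p v - Lam n p y)
      (Lam n p v - Lam n p y) < 1 :=
    hc.continuousAt.eventually_lt_const (by simp [traceForm])
  filter_upwards [h0] with v hv
  rw [mem_dualCone_iff_posSemidef p]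
  have := posSemidef_add_of_traceForm_le hy ((Lam_isSymm p v).sub (Lam_isSymm p y)) hv.le
  simpa using this

/-- Existence of a gradient certificate. -/
theorem exists_gradient_certificate {t : Fin (n + 1) → ℝ} {ε : ℝ} (hε : 0 < ε)
    (ht : ∀ x ∈ dualCone (wsosCone n), ε * x 0 ≤ t ⬝ᵥ x) :
    ∃ x, (Lam n p x).PosDef ∧ ∀ k, ((Lam n p x)⁻¹ * Lam n p k).trace = t ⬝ᵥ k := by
  have hn : (0 : ℝ) < n + 1 := by positivity
  have hne : Nonempty ((i : Fin 2) × Fin (blockSize n i)) :=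
    Fintype.card_pos_iff.1 (by rw [card_index]; omega)
  -- The level `n + 1 = tr I` makes the Lagrange multiplier equal to `1`. Compactness comes from
  -- `ε‖x‖ ≤ tᵀx` on `Σ*`.
  set A : Set (Fin (n + 1) → ℝ) := {x | x ∈ dualCone (wsosCone n) ∧ t ⬝ᵥ x = n + 1} with hA
  have hAc : IsCompact A := by
    refine Metric.isCompact_of_isClosed_isBounded ?_ ?_
    · exact (isClosed_dualCone _).inter
        (isClosed_eq (continuous_const.dotProduct continuous_id) continuous_const)
    · refine (Metric.isBounded_closedBall (x := 0) (r := (n + 1) / ε)).subset fun x hx => ?_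
      rw [mem_closedBall_zero_iff, norm_eq_apply_zero hx.1, le_div_iff₀ hε, mul_comm]
      exact (ht x hx.1).trans_eq hx.2
  obtain ⟨x₁, hx₁A, hx₁⟩ : ∃ x₁ ∈ A, (Lam n p x₁).PosDef := by
    obtain ⟨x₀, hx₀⟩ := exists_posDef_Lam p
    have hm := (mem_dualCone_iff_posSemidef p).2 hx₀.posSemidef
    have hpos : 0 < t ⬝ᵥ x₀ := by
      refine lt_of_lt_of_le (mul_pos hε ?_) (ht x₀ hm)
      rw [← norm_eq_apply_zero hm, norm_pos_iff]
      rintro rfl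
      have h0 := hx₀.det_pos
      rw [← LamLin_apply, map_zero, det_zero] at h0
      exact lt_irrefl _ h0
    refine ⟨((n + 1) / (t ⬝ᵥ x₀)) • x₀, ⟨smul_mem_dualCone (by positivity) hm, ?_⟩, ?_⟩
    · rw [dotProduct_smul, smul_eq_mul, div_mul_cancel₀ _ hpos.ne']
    · rw [Lam_smul]
      exact hx₀.smul (by positivity)
  obtain ⟨x, hxA, hmax⟩ := hAc.exists_isMaxOn ⟨x₁, hx₁A⟩
    (contDiff_det_Lam p).continuous.continuousOn
  have hdet : 0 < (Lam n p x).det := hx₁.det_pos.trans_le (hmax hx₁A)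
  have hX : (Lam n p x).PosDef :=
    ((mem_dualCone_iff_posSemidef p).1 hxA.1).posDef_iff_det_ne_zero.2 hdet.ne'
  have hXu : IsUnit (Lam n p x).det := isUnit_iff_ne_zero.2 hdet.ne'
  have hcrit : ∀ h, t ⬝ᵥ h = 0 → ((Lam n p x)⁻¹ * Lam n p h).trace = 0 := by
    intro h hh
    have hloc : IsLocalMax (fun s : ℝ => (Lam n p x + s • Lam n p h).det) 0 := by
      have hc : Continuous fun s : ℝ =>
          s * (s * traceForm (Lam n p x) (Lam n p h) (Lam n p h)) := by fun_prop
      have hev : ∀ᶠ s in nhds (0 : ℝ),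
          s * (s * traceForm (Lam n p x) (Lam n p h) (Lam n p h)) < 1 :=
        hc.continuousAt.eventually_lt_const (by simp)
      filter_upwards [hev] with s hs
      have hmem : x + s • h ∈ A := by
        refine ⟨?_, by rw [dotProduct_add, dotProduct_smul, hh, smul_zero, add_zero, hxA.2]⟩
        rw [mem_dualCone_iff_posSemidef p, Lam_line]
        refine posSemidef_add_of_traceForm_le hX ((Lam_isSymm p h).smul s) ?_
        rw [traceForm_smul_left, traceForm_comm, traceForm_smul_left]
        exact hs.le
      have := hmax hmem
      simpa [Lam_line] using this
    have := hloc.hasDerivAt_eq_zero (hasDerivAt_det_line hXu)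
    exact (mul_eq_zero.1 this).resolve_left hdet.ne'
  refine ⟨x, hX, fun k => ?_⟩
  -- Projects `k` along `x` onto the hyperplane `tᵀh = 0`.
  have h1 := hcrit (k - ((t ⬝ᵥ k) / (n + 1)) • x) (by
    rw [dotProduct_sub, dotProduct_smul, hxA.2, smul_eq_mul]
    field_simp
    ring)
  rw [Lam_sub, Lam_smul, Matrix.mul_sub,
    Matrix.mul_smul, Matrix.nonsing_inv_mul _ hXu, trace_sub, trace_smul, trace_one,
    card_index] at h1
  push_cast at h1
  rw [smul_eq_mul, div_mul_cancel₀ _ hn.ne'] at h1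
  linarith

/-- Vectors close to a gradient certificate are certificates. -/
theorem isDualCertificate_of_traceForm_lt {t x y : Fin (n + 1) → ℝ} (hX : (Lam n p x).PosDef)
    (hx : ∀ k, ((Lam n p x)⁻¹ * Lam n p k).trace = t ⬝ᵥ k)
    (hxy : traceForm (Lam n p x) (Lam n p (y - x)) (Lam n p (y - x)) < 1) :
    IsDualCertificate n p t y := by
  have hY : (Lam n p y).PosDef := by
    have := posDef_add_of_traceForm_lt hX (Lam_isSymm p (y - x)) hxy
    rwa [Lam_sub, add_sub_cancel] at this
  have hYu : IsUnit (Lam n p y).det := isUnit_iff_ne_zero.2 hY.det_pos.ne'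
  refine ⟨mem_interior_dualCone p hY, ?_⟩
  set w := (hessian (barrier n p) y)⁻¹ *ᵥ t with hw
  have hHw : hessian (barrier n p) y *ᵥ w = t := by
    rw [hw, mulVec_mulVec, Matrix.mul_nonsing_inv _ (isUnit_det_hessian_barrier p hY), one_mulVec]
  -- From `H(y)w = t` and `⟨Λ(y), B⟩_{Λ(y)} = tr(Λ(y)⁻¹B)`.
  have hform : traceForm (Lam n p y) (Lam n p (w - y)) (Lam n p (w - y)) =
      ((Lam n p x)⁻¹ * Lam n p (w - y)).trace - ((Lam n p y)⁻¹ * Lam n p (w - y)).trace := by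
    conv_lhs => rw [Lam_sub p w y]
    rw [← Lam_sub p w y, hx, traceForm_comm]
    nth_rw 1 [Lam_sub p w y]
    rw [traceForm_sub_left, traceForm_comm, ← hessian_barrier_mulVec p hY.det_pos.ne', hHw,
      dotProduct_comm]
    congr 1
    rw [traceForm, Matrix.nonsing_inv_mul _ hYu, Matrix.one_mul]
  have hle := traceForm_newton_le hX hY (Lam_isSymm p (w - y)) hform
  rw [← Lam_sub] at hle
  have := posSemidef_add_of_traceForm_le hY (Lam_isSymm p (w - y)) (hle.trans hxy.le)
  rw [Lam_sub, add_sub_cancel] at this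
  exact (mem_dualCone_iff_posSemidef p).2 this

theorem isDualCertificate_smul {t y : Fin (n + 1) → ℝ} (h : IsDualCertificate n p t y) {c : ℝ}
    (hc : 0 ≤ c) : IsDualCertificate n p (c • t) y :=
  ⟨h.1, by rw [mulVec_smul]; exact smul_mem_dualCone hc h.2⟩

theorem toLp_norm_sq (t : Fin (n + 1) → ℝ) : ‖WithLp.toLp 2 t‖ ^ 2 = t ⬝ᵥ t := by
  rw [EuclideanSpace.norm_sq_eq]
  simp [dotProduct, sq]

/-- Pairing with `oneVec ∈ Σ*` gives `ε ≤ t 0`. This keeps `log ‖t‖ + log (1/ε)` nonnegative. -/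
theorem le_norm_of_sub_smul_mem {t : Fin (n + 1) → ℝ} {ε : ℝ}
    (ht : t - ε • oneVec n ∈ closure (wsosCone n)) : ε ≤ ‖WithLp.toLp 2 t‖ := by
  have h := dotProduct_nonneg_of_mem_closure ht (oneVec_mem_dualCone n)
  rw [dotProduct_comm, oneVec_dotProduct] at h
  have h1 : ε ≤ t 0 := by simpa [oneVec] using h
  refine h1.trans ((le_abs_self _).trans ?_)
  exact PiLp.norm_apply_le (WithLp.toLp 2 t) 0

theorem traceForm_le_of_gradient {t x : Fin (n + 1) → ℝ} (hX : (Lam n p x).PosDef)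
    (hx : ∀ k, ((Lam n p x)⁻¹ * Lam n p k).trace = t ⬝ᵥ k) (h : Fin (n + 1) → ℝ) :
    traceForm (Lam n p x) (Lam n p h) (Lam n p h) ≤ 2 * (t ⬝ᵥ t) * (h ⬝ᵥ h) := by
  obtain ⟨c, hc, hg⟩ := exists_eq_sum_q n h
  have h1 := traceForm_self_sum_le hX (V := fun k => Lam n p (q n (chebNode n k)))
    (fun k => (mem_dualCone_iff_posSemidef p).1 (q_mem_dualCone n (chebNode_mem_Icc n k))) c
  have h2 : ∑ k, c k • Lam n p (q n (chebNode n k)) = Lam n p h := by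
    conv_rhs => rw [hc]
    simp only [← LamLin_apply, map_sum, map_smul]
  rw [h2] at h1
  simp only [hx] at h1
  set g := ∑ k, |c k| • q n (chebNode n k)
  have h3 : ∑ k, |c k| * t ⬝ᵥ q n (chebNode n k) = t ⬝ᵥ g := by
    simp [g, dotProduct_sum]
  rw [h3] at h1
  have h4 : (t ⬝ᵥ g) ^ 2 ≤ (t ⬝ᵥ t) * (g ⬝ᵥ g) := by
    have := Finset.sum_mul_sq_le_sq_mul_sq Finset.univ t g
    simpa [dotProduct, sq] using this
  have h5 : 0 ≤ t ⬝ᵥ t := by simpa using dotProduct_star_self_nonneg t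
  calc _ ≤ _ := h1
    _ ≤ _ := h4
    _ ≤ (t ⬝ᵥ t) * (2 * (h ⬝ᵥ h)) := mul_le_mul_of_nonneg_left hg h5
    _ = _ := by ring

theorem exists_integer_certificate {t : Fin (n + 1) → ℝ} {ε D : ℝ} (hε : 0 < ε)
    (hD : (n : ℝ) + 1 ≤ D) (ht : t - ε • oneVec n ∈ closure (wsosCone n)) :
    ∃ y : Fin (n + 1) → ℤ, IsDualCertificate n p t (fun l => (y l : ℝ)) ∧
      ‖fun l => (y l : ℝ)‖ ≤ 1 / 2 + D / ε * (3 * √D * ‖WithLp.toLp 2 t‖) := by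
  have hn : (0 : ℝ) < n + 1 := by positivity
  have hD0 : 0 < D := hn.trans_le hD
  have htpos : 0 < ‖WithLp.toLp 2 t‖ := hε.trans_le (le_norm_of_sub_smul_mem ht)
  -- Scaling `t` down by `N` scales its gradient certificate up by `N`, so that rounding errors
  -- become small in the local norm.
  set N : ℝ := 3 * √D * ‖WithLp.toLp 2 t‖ with hN
  have hN0 : 0 < N := by positivity
  have hN2 : N ^ 2 = 9 * D * (t ⬝ᵥ t) := by
    rw [hN, mul_pow, mul_pow, Real.sq_sqrt hD0.le, toLp_norm_sq]
    ring
  have htt : 0 < t ⬝ᵥ t := by rw [← toLp_norm_sq]; positivity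
  have hdual : ∀ x ∈ dualCone (wsosCone n), ε / N * x 0 ≤ (N⁻¹ • t) ⬝ᵥ x := by
    intro x hx
    have h := dotProduct_nonneg_of_mem_closure ht hx
    rw [sub_dotProduct, smul_dotProduct, oneVec_dotProduct, smul_eq_mul] at h
    rw [smul_dotProduct, smul_eq_mul, div_mul_eq_mul_div, inv_mul_eq_div]
    exact div_le_div_of_nonneg_right (by linarith) hN0.le
  obtain ⟨x, hX, hx⟩ := exists_gradient_certificate p (div_pos hε hN0) hdual
  have hround : ∀ l, |((round (x l) : ℤ) : ℝ) - x l| ≤ 1 / 2 := fun l => by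
    rw [abs_sub_comm]; exact abs_sub_round _
  refine ⟨fun l => round (x l), ?_, ?_⟩
  · have hcert : IsDualCertificate n p (N⁻¹ • t) (fun l => ((round (x l) : ℤ) : ℝ)) := by
      refine isDualCertificate_of_traceForm_lt p hX hx ((traceForm_le_of_gradient p hX hx _).trans_lt ?_)
      set h : Fin (n + 1) → ℝ := (fun l => ((round (x l) : ℤ) : ℝ)) - x with hh
      have h1 : h ⬝ᵥ h ≤ D / 4 := by
        calc h ⬝ᵥ h ≤ ∑ _l : Fin (n + 1), (1 / 4 : ℝ) := by
              refine Finset.sum_le_sum fun l _ => ?_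
              have := hround l
              rw [← abs_mul_abs_self]
              change |((round (x l) : ℤ) : ℝ) - x l| * |((round (x l) : ℤ) : ℝ) - x l| ≤ _
              nlinarith [abs_nonneg (((round (x l) : ℤ) : ℝ) - x l)]
          _ = ((n : ℝ) + 1) / 4 := by simp; ring
          _ ≤ D / 4 := by linarith
      rw [smul_dotProduct, dotProduct_smul, smul_eq_mul, smul_eq_mul]
      have h2 : N⁻¹ * (N⁻¹ * (t ⬝ᵥ t)) = 1 / (9 * D) := by
        rw [← mul_assoc, ← mul_inv, ← sq, hN2]
        field_simp
      rw [h2]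
      -- The rounding error has squared Euclidean length at most `(n+1)/4 ≤ D/4`.
      calc 2 * (1 / (9 * D)) * (h ⬝ᵥ h) ≤ 2 * (1 / (9 * D)) * (D / 4) := by gcongr
        _ = 1 / 18 := by field_simp; norm_num
        _ < 1 := by norm_num
    have := isDualCertificate_smul p hcert hN0.le
    rwa [smul_smul, mul_inv_cancel₀ hN0.ne', one_smul] at this
  · have hm := (mem_dualCone_iff_posSemidef p).2 hX.posSemidef
    have h1 := hdual x hm
    rw [← hx x, Matrix.nonsing_inv_mul _ (isUnit_iff_ne_zero.2 hX.det_pos.ne'), trace_one,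
      card_index, ← norm_eq_apply_zero hm] at h1
    push_cast at h1
    have h2 : ‖x‖ ≤ D / ε * N := by
      rw [div_mul_eq_mul_div, div_le_iff₀ hN0] at h1
      rw [div_mul_eq_mul_div, le_div_iff₀ hε]
      nlinarith
    have h3 : 0 ≤ D / ε * N := by positivity
    refine (pi_norm_le_iff_of_nonneg (by linarith)).2 fun l => ?_
    have h4 := norm_le_pi_norm x l
    rw [Real.norm_eq_abs] at h4 ⊢
    have h5 := abs_sub_abs_le_abs_sub ((round (x l) : ℤ) : ℝ) (x l)
    have h6 := hround l
    linarith

end Certificates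

/-! ### Logarithmic size estimates -/

section BitSize

theorem log_bounds {d : ℕ} {τ ε Y : ℝ} (hε : 0 < ε) (hτ : ε ≤ τ)
    (hY : Y ≤ 1 / 2 + (2 * d + 2) / ε * (3 * √(2 * d + 2) * τ)) (hY0 : 0 ≤ Y) :
    Real.log (Y + 1) ≤ 6 * (Real.log (d + 2) + Real.log τ + Real.log (1 / ε)) ∧
      Real.log 2 ≤ Real.log (d + 2) + Real.log τ + Real.log (1 / ε) := by
  have hτ0 : 0 < τ := hε.trans_le hτ
  have hd : (0 : ℝ) ≤ d := d.cast_nonneg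
  obtain ⟨D, hD⟩ : ∃ D : ℝ, D = d + 2 := ⟨_, rfl⟩
  obtain ⟨R, hR⟩ : ∃ R : ℝ, R = τ / ε := ⟨_, rfl⟩
  have hD2 : 2 ≤ D := by linarith
  have hR1 : 1 ≤ R := by rw [hR, one_le_div hε]; exact hτ
  have hlogR : Real.log τ + Real.log (1 / ε) = Real.log R := by
    rw [hR, ← Real.log_mul hτ0.ne' (by positivity)]
    congr 1
    ring
  rw [add_assoc, hlogR, ← hD]
  have hlR := Real.log_nonneg hR1
  have hlD : Real.log 2 ≤ Real.log D := Real.log_le_log (by norm_num) hD2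
  refine ⟨?_, by linarith⟩
  have hsq : √(2 * d + 2) ≤ D := by
    rw [Real.sqrt_le_left (by linarith), hD]
    nlinarith
  have h1 : (2 * d + 2) / ε * (3 * √(2 * d + 2) * τ) = (2 * d + 2) * (3 * √(2 * d + 2)) * R := by
    rw [hR]; field_simp
  have h2 : (2 * (d : ℝ) + 2) * (3 * √(2 * d + 2)) ≤ 6 * D ^ 2 := by
    have h3 : 2 * (d : ℝ) + 2 ≤ 2 * D := by linarith
    calc (2 * (d : ℝ) + 2) * (3 * √(2 * d + 2)) ≤ 2 * D * (3 * D) := by gcongr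
      _ = 6 * D ^ 2 := by ring
  -- `D ≥ 2` and `R ≥ 1` let powers of `D` absorb the numerical constants.
  have h3 : Y + 1 ≤ D ^ 6 * R := by
    have h4 : 16 ≤ D ^ 4 := by
      calc (16 : ℝ) = 2 ^ 4 := by norm_num
        _ ≤ D ^ 4 := by gcongr
    have h5 : 0 < D ^ 2 := by positivity
    have h6 : 4 ≤ D ^ 2 := by nlinarith
    have h7 : 16 * D ^ 2 ≤ D ^ 6 := by nlinarith
    have h8 : (2 * (d : ℝ) + 2) * (3 * √(2 * d + 2)) * R ≤ 6 * D ^ 2 * R := by gcongr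
    rw [h1] at hY
    calc Y + 1 ≤ 3 / 2 + 6 * D ^ 2 * R := by linarith
      _ ≤ 16 * D ^ 2 * R := by nlinarith
      _ ≤ D ^ 6 * R := by gcongr
  calc Real.log (Y + 1) ≤ Real.log (D ^ 6 * R) := Real.log_le_log (by linarith) h3
    _ = 6 * Real.log D + Real.log R := by
      rw [Real.log_mul (by positivity) (by positivity), Real.log_pow]; norm_num
    _ ≤ _ := by linarith

theorem bitSize_le (y : ℤ) : (bitSize y : ℝ) ≤ 2 + 2 * Real.log (|(y : ℝ)| + 1) := by
  have h0 : 0 ≤ Real.log (|(y : ℝ)| + 1) := Real.log_nonneg (by linarith [abs_nonneg (y : ℝ)])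
  have h1 := (Int.ceil_lt_add_one (Real.logb 2 (|(y : ℝ)| + 1))).le
  have h2 : Real.logb 2 (|(y : ℝ)| + 1) ≤ 2 * Real.log (|(y : ℝ)| + 1) := by
    rw [Real.logb, div_le_iff₀ (Real.log_pos one_lt_two)]
    nlinarith [Real.log_two_gt_d9]
  rw [bitSize]
  push_cast
  linarith

end BitSize

theorem mainTheorem5 :
    (∀ n : ℕ, IsLeast (k1Set n (oneVec n)) (k1 n (oneVec n)) ∧ 1 ≤ k1 n (oneVec n)) ∧
    (∀ n : ℕ, (∀ l, chebNode n l ∈ Set.Icc (-1 : ℝ) 1) ∧ Unisolvent n (chebNode n) ∧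
      ∃ α : Fin (n + 1) → ℝ, (∀ l, 0 < α l) ∧
        (matM n α (chebNode n)).PosDef ∧ condNumber (matM n α (chebNode n)) ≤ 4) ∧
    (∃ K : ℝ, ∀ d n : ℕ, (n = 2 * d ∨ n = 2 * d + 1) →
      ∀ (p : PBases n) (t : Fin (n + 1) → ℝ) (ε : ℝ), 0 < ε →
        t ∈ interior (wsosCone n) → t - ε • oneVec n ∈ frontier (wsosCone n) →
        ∃ y : Fin (n + 1) → ℤ,
          IsDualCertificate n p t (fun l => (y l : ℝ)) ∧
          ‖fun l => (y l : ℝ)‖ ≤ 1 / 2 + (2 * d + 2) / ε *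
            (⌈3 * √(2 * d + 2) * ‖WithLp.toLp 2 t‖⌉ : ℤ) ∧
          Real.log ‖fun l => (y l : ℝ)‖ ≤
            K * (Real.log (d + 2) + Real.log ‖WithLp.toLp 2 t‖ + Real.log (1 / ε)) ∧
          ∀ l, (bitSize (y l) : ℝ) ≤
            K * (Real.log (d + 2) + Real.log ‖WithLp.toLp 2 t‖ + Real.log (1 / ε))) := by
  -- `K = 16`: the bit size is at most `2 + 2·6A` for the bracket `A`, and `2 ≤ 4A` because `A ≥ log
  -- 2`.
  refine ⟨isLeast_k1, fun n => ⟨chebNode_mem_Icc n, unisolvent_chebNode n, exists_condNumber_le n⟩,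
    16, ?_⟩
  intro d n hdn p t ε hε _ hfr
  have hcl := frontier_subset_closure hfr
  have hD : (n : ℝ) + 1 ≤ 2 * d + 2 := by
    have : n + 1 ≤ 2 * d + 2 := by omega
    exact_mod_cast this
  obtain ⟨y, hy, hle⟩ := exists_integer_certificate p hε hD hcl
  obtain ⟨h1, h2⟩ := log_bounds hε (le_norm_of_sub_smul_mem hcl) hle (norm_nonneg _)
  have hl2 := Real.log_two_gt_d9
  refine ⟨y, hy, hle.trans ?_, ?_, fun l => ?_⟩
  · gcongr
    exact Int.le_ceil _
  · have h3 : Real.log ‖fun l => (y l : ℝ)‖ ≤ Real.log (‖fun l => (y l : ℝ)‖ + 1) := by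
      -- The zero case relies on `Real.log 0 = 0`.
      rcases (norm_nonneg fun l => (y l : ℝ)).eq_or_lt with h | h
      · rw [← h]; simp
      · exact Real.log_le_log h (by linarith)
    linarith
  · have h3 : Real.log (|(y l : ℝ)| + 1) ≤ Real.log (‖fun l => (y l : ℝ)‖ + 1) := by
      refine Real.log_le_log (by positivity) ?_
      have := norm_le_pi_norm (fun l => (y l : ℝ)) l
      rw [Real.norm_eq_abs] at this
      linarith
    have h4 := bitSize_le (y l)
    linarith
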